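/- Let $\Bbbk$ be a field of arbitrary characteristic, $V$ a finite-dimensional $\Bbbk$-vector space, and $G\le GL(V)$ a (possibly infinite) subgroup acting irreducibly on $V$. Let $\mathcal S=\{s\in G:\dim (1-s)V=1\}$ be the set of complex reflections in $G$. A linear map $\delta\colon V\to \Bbbk G\otimes V$, $\delta(v)=\sum_{h\in G}h\otimes L_h(v)$, is called a quasicoaction; it is Yetter--Drinfeld if $g(L_h(v))=L_{ghg^{-1}}(g(v))$ for all $g,h\in G$, $v\in V$. Let $\widetilde A$ be the algebra generated by $V$, the algebra $\Bbbk G$ and $V^*$ (with $1_{\Bbbk G}=1_{\widetilde A}$) subject to $$g v=g(v)\,g,\qquad f g=g\,(f\circ g),\qquad fv-vf=\sum_{h\in G}\langle f,L_h(v)\rangle h\qquad(g\in G,\ v\in V,\ f\in V^*).$$ A $(V,\delta)$-braided double $U^-\rtimes\Bbbk G\ltimes U^+$ consists of a Yetter--Drinfeld quasicoaction $\delta$ and two-sided ideals $I^-\subseteq T^{>0}(V)$, $I^+\subseteq T^{>0}(V^*)$ such that, with $U^-=T(V)/I^-$ and $U^+=T(V^*)/I^+$, the multiplication map $U^-\otimes\Bbbk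 G\otimes U^+\to\widetilde A/\langle I^-,I^+\rangle$ is bijective. For $t\in\Bbbk$ and a finitely supported function $c\colon\mathcal S\to\Bbbk$, $s\mapsto c_s$, with $c_{gsg^{-1}}=c_s$ for all $g\in G$, put $$\delta_{t,c}(v)=1\otimes tv+\sum_{s\in\mathcal S}c_s\,s\otimes(v-s(v)).$$ 1. Assume that $\operatorname{End}_{\Bbbk G}(V)=\Bbbk$ (this is automatic if $\Bbbk$ is algebraically closed or if $\mathcal S\neq\emptyset$). Let $\delta\colon V\to\Bbbk G\otimes V$ be a linear map. There exists a $(V,\delta)$-braided double $U^-\rtimes\Bbbk G\ltimes U^+$ with $U^-$ and $U^+$ both commutative if and only if $\delta=\delta_{t,c}$ for some $t$ and $c$ as above. 2. For all $t$ and $c$ as above (without the assumption on $\operatorname{End}_{\Bbbk G}(V)$), there exists a $(V,\delta_{t,c})$-braided double of the form $S(V)\rtimes\Bbbk G\ltimes S(V^*)$, that is, with $I^-$ and $I^+$ the kernels of $T(V)\to S(V)$ and $T(V^*)\to S(V^*)$. -/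

import Mathlib

open scoped TensorProduct

noncomputable section

namespace BraidedDoubles

/-! ### Quasi-Yetter-Drinfeld modules over a group algebra -/

section General

universe u v w

variable {k : Type u} {G : Type v} {V : Type w} [Field k] [Group G] [AddCommGroup V] [Module k V]

/-- A quasicoaction `δ : V → kG ⊗ V` on a representation `ρ` of `G` is Yetter-Drinfeld compatible
if `(g ▷ v)^[-1] g ⊗ (g ▷ v)^[0] = g v^[-1] ⊗ g ▷ v^[0]` for all group elements `g`
(these are grouplike and span `kG`). -/
def IsYetterDrinfeld (ρ : Representation k G V)
    (δ : V →ₗ[k] MonoidAlgebra k G ⊗[k] V) : Prop :=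
  ∀ (g : G) (v : V),
    (LinearMap.mulRight k (MonoidAlgebra.of k G g)).rTensor V (δ (ρ g v)) =
      TensorProduct.map (LinearMap.mulLeft k (MonoidAlgebra.of k G g)) (ρ g) (δ v)

/-- The `kG`-valued pairing attached to a quasicoaction: `β(f, v) = v^[-1] ⟨f, v^[0]⟩`. -/
def pairing (δ : V →ₗ[k] MonoidAlgebra k G ⊗[k] V) (f : Module.Dual k V) (v : V) :
    MonoidAlgebra k G :=
  TensorProduct.rid k (MonoidAlgebra k G) (f.lTensor (MonoidAlgebra k G) (δ v))

/-! ### The algebra generated by `V`, `kG` and `V*` -/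

/-- The free algebra on the vector space `V ⊕ kG ⊕ V*`. -/
abbrev Gen (k : Type u) (G : Type v) (V : Type w) [Field k] [Group G] [AddCommGroup V]
    [Module k V] :=
  TensorAlgebra k (V × MonoidAlgebra k G × Module.Dual k V)

/-- The generators `v ∈ V`. -/
def genV : V →ₗ[k] Gen k G V :=
  TensorAlgebra.ι k ∘ₗ LinearMap.inl k V (MonoidAlgebra k G × Module.Dual k V)

/-- The generators `h ∈ kG`. -/
def genH : MonoidAlgebra k G →ₗ[k] Gen k G V :=
  TensorAlgebra.ι k ∘ₗ LinearMap.inr k V (MonoidAlgebra k G × Module.Dual k V) ∘ₗ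
    LinearMap.inl k (MonoidAlgebra k G) (Module.Dual k V)

/-- The generators `f ∈ V*`. -/
def genD : Module.Dual k V →ₗ[k] Gen k G V :=
  TensorAlgebra.ι k ∘ₗ LinearMap.inr k V (MonoidAlgebra k G × Module.Dual k V) ∘ₗ
    LinearMap.inr k (MonoidAlgebra k G) (Module.Dual k V)

/-- The defining relations: all relations of the unital algebra `kG`, the semidirect product
relations `g v = (g ▷ v) g` and `f g = g (f ◁ g)` with `⟨f ◁ g, v⟩ = ⟨f, g ▷ v⟩`, and the
commutator relation `f v - v f = β(f, v)`. -/
inductive Rel (ρ : Representation k G V) (δ : V →ₗ[k] MonoidAlgebra k G ⊗[k] V) :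
    Gen k G V → Gen k G V → Prop
  | one : Rel ρ δ (genH 1) 1
  | mul (a b : MonoidAlgebra k G) : Rel ρ δ (genH (a * b)) (genH a * genH b)
  | smash_left (g : G) (v : V) :
      Rel ρ δ (genH (MonoidAlgebra.of k G g) * genV v)
        (genV (ρ g v) * genH (MonoidAlgebra.of k G g))
  | smash_right (f : Module.Dual k V) (g : G) :
      Rel ρ δ (genD f * genH (MonoidAlgebra.of k G g))
        (genH (MonoidAlgebra.of k G g) * genD ((ρ g).dualMap f))
  | comm (f : Module.Dual k V) (v : V) :
      Rel ρ δ (genD f * genV v - genV v * genD f) (genH (pairing δ f v))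

/-- The algebra `Ã` generated by `V`, `kG`, `V*` subject to the defining relations. -/
abbrev ATilde (ρ : Representation k G V) (δ : V →ₗ[k] MonoidAlgebra k G ⊗[k] V) :=
  RingQuot (Rel ρ δ)

/-- The algebra map `T(V) → Ã`. -/
def tildeV (ρ : Representation k G V) (δ : V →ₗ[k] MonoidAlgebra k G ⊗[k] V) :
    TensorAlgebra k V →ₐ[k] ATilde ρ δ :=
  TensorAlgebra.lift k ((RingQuot.mkAlgHom k (Rel ρ δ)).toLinearMap ∘ₗ genV)

/-- The linear map `kG → Ã`. -/
def tildeH (ρ : Representation k G V) (δ : V →ₗ[k] MonoidAlgebra k G ⊗[k] V) :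
    MonoidAlgebra k G →ₗ[k] ATilde ρ δ :=
  (RingQuot.mkAlgHom k (Rel ρ δ)).toLinearMap ∘ₗ genH

/-- The algebra map `T(V*) → Ã`. -/
def tildeD (ρ : Representation k G V) (δ : V →ₗ[k] MonoidAlgebra k G ⊗[k] V) :
    TensorAlgebra k (Module.Dual k V) →ₐ[k] ATilde ρ δ :=
  TensorAlgebra.lift k ((RingQuot.mkAlgHom k (Rel ρ δ)).toLinearMap ∘ₗ genD)

/-! ### Quotients by relations in `T(V)` and in `T(V*)` -/

/-- The relations `x = 0` for `x ∈ I⁻` and `y = 0` for `y ∈ I⁺`. -/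
inductive QRel (ρ : Representation k G V) (δ : V →ₗ[k] MonoidAlgebra k G ⊗[k] V)
    (Im : Ideal (TensorAlgebra k V)) (Ip : Ideal (TensorAlgebra k (Module.Dual k V))) :
    ATilde ρ δ → ATilde ρ δ → Prop
  | minus (x : TensorAlgebra k V) (hx : x ∈ Im) : QRel ρ δ Im Ip (tildeV ρ δ x) 0
  | plus (y : TensorAlgebra k (Module.Dual k V)) (hy : y ∈ Ip) : QRel ρ δ Im Ip (tildeD ρ δ y) 0

/-- The quotient of `Ã` by the two-sided ideal generated by `I⁻` and `I⁺`. -/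
abbrev AQuot (ρ : Representation k G V) (δ : V →ₗ[k] MonoidAlgebra k G ⊗[k] V)
    (Im : Ideal (TensorAlgebra k V)) (Ip : Ideal (TensorAlgebra k (Module.Dual k V))) :=
  RingQuot (QRel ρ δ Im Ip)

section Maps

variable (ρ : Representation k G V) (δ : V →ₗ[k] MonoidAlgebra k G ⊗[k] V)
  (Im : Ideal (TensorAlgebra k V)) (Ip : Ideal (TensorAlgebra k (Module.Dual k V)))

/-- The algebra map `T(V)/I⁻ → Ã/⟨I⁻, I⁺⟩`. -/
def quotV [Im.IsTwoSided] : (TensorAlgebra k V ⧸ Im) →ₐ[k] AQuot ρ δ Im Ip :=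
  Ideal.Quotient.liftₐ Im ((RingQuot.mkAlgHom k (QRel ρ δ Im Ip)).comp (tildeV ρ δ))
    (fun x hx => by
      have h := RingQuot.mkAlgHom_rel k (QRel.minus (ρ := ρ) (δ := δ) (Ip := Ip) x hx)
      simpa using h)

/-- The linear map `kG → Ã/⟨I⁻, I⁺⟩`. -/
def quotH : MonoidAlgebra k G →ₗ[k] AQuot ρ δ Im Ip :=
  (RingQuot.mkAlgHom k (QRel ρ δ Im Ip)).toLinearMap ∘ₗ tildeH ρ δ

/-- The algebra map `T(V*)/I⁺ → Ã/⟨I⁻, I⁺⟩`. -/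
def quotD [Ip.IsTwoSided] :
    (TensorAlgebra k (Module.Dual k V) ⧸ Ip) →ₐ[k] AQuot ρ δ Im Ip :=
  Ideal.Quotient.liftₐ Ip ((RingQuot.mkAlgHom k (QRel ρ δ Im Ip)).comp (tildeD ρ δ))
    (fun y hy => by
      have h := RingQuot.mkAlgHom_rel k (QRel.plus (ρ := ρ) (δ := δ) (Im := Im) y hy)
      simpa using h)

/-- The multiplication map `T(V)/I⁻ ⊗ kG ⊗ T(V*)/I⁺ → Ã/⟨I⁻, I⁺⟩`, `b ⊗ h ⊗ φ ↦ b h φ`. -/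
def mulMap [Im.IsTwoSided] [Ip.IsTwoSided] :
    (TensorAlgebra k V ⧸ Im) ⊗[k]
      (MonoidAlgebra k G ⊗[k] (TensorAlgebra k (Module.Dual k V) ⧸ Ip)) →ₗ[k]
        AQuot ρ δ Im Ip :=
  LinearMap.mul' k (AQuot ρ δ Im Ip) ∘ₗ
    TensorProduct.map (quotV ρ δ Im Ip).toLinearMap
      (LinearMap.mul' k (AQuot ρ δ Im Ip) ∘ₗ
        TensorProduct.map (quotH ρ δ Im Ip) (quotD ρ δ Im Ip).toLinearMap)

end Maps

/-! ### Braided doubles -/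

/-- A `(V, δ)`-braided double over `kG`: the quasicoaction `δ` is Yetter-Drinfeld, `I⁻ ⊆ T^{>0}(V)`
and `I⁺ ⊆ T^{>0}(V*)` are two-sided ideals, and the algebra `Ã/⟨I⁻, I⁺⟩` has triangular
decomposition `T(V)/I⁻ ⋊ kG ⋉ T(V*)/I⁺`. -/
structure BraidedDouble (ρ : Representation k G V)
    (δ : V →ₗ[k] MonoidAlgebra k G ⊗[k] V) where
  yetterDrinfeld : IsYetterDrinfeld ρ δ
  Iminus : Ideal (TensorAlgebra k V)
  Iplus : Ideal (TensorAlgebra k (Module.Dual k V))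
  twoSided_minus : Iminus.IsTwoSided
  twoSided_plus : Iplus.IsTwoSided
  Iminus_le : Iminus ≤ RingHom.ker (TensorAlgebra.algebraMapInv : TensorAlgebra k V →ₐ[k] k)
  Iplus_le : Iplus ≤
    RingHom.ker (TensorAlgebra.algebraMapInv : TensorAlgebra k (Module.Dual k V) →ₐ[k] k)
  triangular : Function.Bijective (mulMap ρ δ Iminus Iplus)

attribute [instance] BraidedDouble.twoSided_minus BraidedDouble.twoSided_plus

namespace BraidedDouble

variable {ρ : Representation k G V} {δ : V →ₗ[k] MonoidAlgebra k G ⊗[k] V}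

/-- The algebra `U⁻ = T(V)/I⁻`. -/
abbrev Uminus (B : BraidedDouble ρ δ) := TensorAlgebra k V ⧸ B.Iminus

/-- The algebra `U⁺ = T(V*)/I⁺`. -/
abbrev Uplus (B : BraidedDouble ρ δ) := TensorAlgebra k (Module.Dual k V) ⧸ B.Iplus

/-- The braided double has the form `S(V) ⋊ kG ⋉ S(V*)`: the ideals `I⁻` and `I⁺` are the
kernels of the canonical maps `T(V) → S(V)` and `T(V*) → S(V*)`. -/
def IsSymmetric (B : BraidedDouble ρ δ) : Prop :=
  B.Iminus = RingHom.ker (SymmetricAlgebra.algHom k V) ∧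
    B.Iplus = RingHom.ker (SymmetricAlgebra.algHom k (Module.Dual k V))

end BraidedDouble

end General

/-! ### Linear groups, complex reflections and the quasicoaction `δ_{t,c}` -/

section LinearGroup

universe u w

variable {k : Type u} {V : Type w} [Field k] [AddCommGroup V] [Module k V]

/-- The natural representation on `V` of a linear group `G ≤ GL(V)`. -/
def naturalRep (G : Subgroup (LinearMap.GeneralLinearGroup k V)) : Representation k G V :=
  (Units.coeHom (Module.End k V)).comp G.subtype

/-- The set of complex reflections in `G`: the `s ∈ G` such that `dim (1 - s) V = 1`. -/
def complexReflections (G : Subgroup (LinearMap.GeneralLinearGroup k V)) : Set G :=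
  {s | Module.finrank k (LinearMap.range (1 - naturalRep G s)) = 1}

/-- A finitely supported function `c` on the set of complex reflections is invariant if
`c_{g s g⁻¹} = c_s` for all `g ∈ G`. -/
def IsConjInvariant (G : Subgroup (LinearMap.GeneralLinearGroup k V))
    (c : complexReflections G →₀ k) : Prop :=
  ∀ (g : G) (s s' : complexReflections G), (s' : G) = g * s * g⁻¹ → c s' = c s

/-- The quasicoaction `δ_{t,c}(v) = 1 ⊗ t v + ∑_s c_s s ⊗ (v - s(v))`. -/
def deltaTC (G : Subgroup (LinearMap.GeneralLinearGroup k V)) (t : k)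
    (c : complexReflections G →₀ k) : V →ₗ[k] MonoidAlgebra k G ⊗[k] V :=
  t • TensorProduct.mk k (MonoidAlgebra k G) V 1 +
    c.sum fun s a =>
      a • (TensorProduct.mk k (MonoidAlgebra k G) V (MonoidAlgebra.of k G s) ∘ₗ
        (1 - naturalRep G s))

end LinearGroup

end BraidedDoubles

end

/-! Everything reduces to two symmetry conditions on the pairing `β(f, v) = ∑_h ⟨f, L_h(v)⟩ h`: in
`Ã`, `[β(f, v), w]` must be symmetric in `v` and `w` (`SymmetricV`), and `[f, β(f', v)]` symmetric
in `f` and `f'` (`SymmetricD`). They say that the commutator relation is consistent with `vw = wv`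
and with `ff' = f'f`.

Sufficiency is a PBW argument with Dunkl operators. On `S(V) ⊗ N`, with `N = kG ⊗ S(V*)`, let `V`
act by multiplication, `G` diagonally, and `f` by the operator determined by its action on `1 ⊗ N`
and the rule `f v = v f + β(f, v)`. `SymmetricV` makes this operator well defined, Yetter-Drinfeld
compatibility makes it equivariant, and `SymmetricD` makes these operators commute. Hence `Ã/⟨I⁻,
I⁺⟩` acts for the symmetric ideals, and `a ↦ a · (1 ⊗ 1 ⊗ 1)` inverts the multiplication map
(`symMul_bijective`).

For necessity, let `U⁻` and `U⁺` be commutative. The kernels of `V → U⁻` and `V* → U⁺` are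
`G`-stable, so by irreducibility each is zero or everything; in the latter case `β = 0` and `δ = 0 =
δ_{0,0}`. Otherwise, moving `f` past `vw = wv`, or `ff' = f'f` past `v`, and comparing normal forms
gives the two conditions.

Componentwise they read `f(L_h v)(hw - w) = f(L_h w)(hv - v)` and `f'(L_h v) f(hw - w) = f(L_h v)
f'(hw - w)`. For `h ≠ 1` they force `L_h = a (1 - h)`, with `1 - h` of rank one unless `a = 0`
(`exists_tcoeff_eq_smul`). For `h = 1` they are empty, but `L_1` commutes with `G` and is therefore
a scalar. Conversely every `δ_{t,c}` satisfies both conditions, because the image of `1 - s` is a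
line. -/

open scoped TensorProduct

noncomputable section

namespace BraidedDoubles

universe u v w x

/-! ### The symmetric algebra as a quotient of the tensor algebra -/

section SymQuot

variable (k : Type u) (V : Type w) [Field k] [AddCommGroup V] [Module k V]

/-- The symmetric algebra, presented as `T(V)` modulo the kernel of `T(V) → S(V)`. -/
def SymQuot : Type max u w := TensorAlgebra k V ⧸ RingHom.ker (SymmetricAlgebra.algHom k V)

namespace SymQuot

instance : Ring (SymQuot k V) :=
  inferInstanceAs (Ring (TensorAlgebra k V ⧸ RingHom.ker (SymmetricAlgebra.algHom k V)))

instance : CommRing (SymQuot k V) where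
  mul_comm a b := by
    obtain ⟨a, rfl⟩ := Ideal.Quotient.mk_surjective a
    obtain ⟨b, rfl⟩ := Ideal.Quotient.mk_surjective b
    change Ideal.Quotient.mk _ (a * b) = Ideal.Quotient.mk _ (b * a)
    rw [Ideal.Quotient.eq, RingHom.mem_ker, map_sub, map_mul, map_mul, mul_comm, sub_self]

instance : Algebra k (SymQuot k V) :=
  inferInstanceAs (Algebra k (TensorAlgebra k V ⧸ RingHom.ker (SymmetricAlgebra.algHom k V)))

/-- The quotient map `T(V) → SymQuot k V`. -/
def mk : TensorAlgebra k V →ₐ[k] SymQuot k V :=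
  Ideal.Quotient.mkₐ k (RingHom.ker (SymmetricAlgebra.algHom k V))

theorem mk_surjective : Function.Surjective (mk k V) := Ideal.Quotient.mk_surjective

/-- The generators of `SymQuot k V`. -/
def ι : V →ₗ[k] SymQuot k V :=
  (mk k V).toLinearMap ∘ₗ TensorAlgebra.ι k

variable {k V} {B : Type x} [Ring B] [Algebra k B]

/-- The kernel of `T(V) → S(V)` comes from the congruence generated by commutators of generators,
and the extension of `j` respects it. The target `B` need not be commutative: later it is an
endomorphism algebra. -/
theorem lift_eq_zero (j : V →ₗ[k] B) (hj : ∀ v w, j v * j w = j w * j v)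
    {y : TensorAlgebra k V} (hy : y ∈ RingHom.ker (SymmetricAlgebra.algHom k V)) :
    TensorAlgebra.lift k j y = 0 := by
  have hle : TensorAlgebra.symRingCon k V ≤ RingCon.ker (TensorAlgebra.lift k j).toRingHom := by
    refine RingCon.ringConGen_le.2 fun a b hab => ?_
    induction hab with
    | mul_comm a b => simp [RingCon.ker_apply, hj a b]
  have h : (TensorAlgebra.symRingCon k V).liftₐ (TensorAlgebra.lift k j) hle
      (SymmetricAlgebra.algHom k V y) = TensorAlgebra.lift k j y := rfl
  rw [← h, (RingHom.mem_ker).1 hy, map_zero]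

/-- A linear map with commuting values extends to `SymQuot k V`. -/
def lift (j : V →ₗ[k] B) (hj : ∀ v w, j v * j w = j w * j v) : SymQuot k V →ₐ[k] B :=
  Ideal.Quotient.liftₐ _ (TensorAlgebra.lift k j) fun _ hy => lift_eq_zero j hj hy

@[simp]
theorem lift_ι (j : V →ₗ[k] B) (hj : ∀ v w, j v * j w = j w * j v) (v : V) :
    lift j hj (ι k V v) = j v := by
  change TensorAlgebra.lift k j (TensorAlgebra.ι k v) = j v
  simp

theorem hom_ext {φ ψ : SymQuot k V →ₐ[k] B} (h : ∀ v, φ (ι k V v) = ψ (ι k V v)) : φ = ψ := by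
  have : φ.comp (mk k V) = ψ.comp (mk k V) := by
    refine TensorAlgebra.hom_ext ?_
    ext v
    exact h v
  ext y
  obtain ⟨z, rfl⟩ := mk_surjective k V y
  exact AlgHom.congr_fun this z

/-- A subspace that contains `1` and is stable under multiplication by generators is everything. -/
theorem eq_top_of_mul_mem (S : Submodule k (SymQuot k V)) (h1 : 1 ∈ S)
    (hS : ∀ v, ∀ y ∈ S, ι k V v * y ∈ S) : S = ⊤ := by
  have key : ∀ z : TensorAlgebra k V, ∀ y ∈ S, mk k V z * y ∈ S := by
    intro z
    induction z using TensorAlgebra.induction with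
    | algebraMap r =>
      intro y hy
      rw [AlgHom.commutes, ← Algebra.smul_def]
      exact S.smul_mem r hy
    | ι v => exact hS v
    | mul a b ha hb =>
      intro y hy
      rw [map_mul, mul_assoc]
      exact ha _ (hb _ hy)
    | add a b ha hb =>
      intro y hy
      rw [map_add, add_mul]
      exact S.add_mem (ha _ hy) (hb _ hy)
  rw [eq_top_iff]
  rintro y -
  obtain ⟨z, rfl⟩ := mk_surjective k V y
  simpa using key z 1 h1

/-- The counit of `T(V)` extends the zero map `V → k`, whose values commute. -/
theorem ker_algHom_le :
    RingHom.ker (SymmetricAlgebra.algHom k V) ≤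
      RingHom.ker (TensorAlgebra.algebraMapInv : TensorAlgebra k V →ₐ[k] k) :=
  fun _ hy => lift_eq_zero (0 : V →ₗ[k] k) (by simp) hy

end SymQuot

end SymQuot

/-! ### Coefficients in `kG ⊗ W` -/

section Coefficients

variable {k : Type u} {G : Type v} {W : Type w} [Field k] [AddCommGroup W] [Module k W]

/-- The coefficient of a group element in `kG`, as a linear form. -/
def gcoeff (h : G) : MonoidAlgebra k G →ₗ[k] k :=
  Finsupp.lapply h ∘ₗ (MonoidAlgebra.coeffLinearEquiv k).toLinearMap

theorem gcoeff_apply (h : G) (a : MonoidAlgebra k G) : gcoeff h a = a.coeff h := rfl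

/-- The component of an element of `kG ⊗ W` at a group element. -/
def tcoeff (h : G) : MonoidAlgebra k G ⊗[k] W →ₗ[k] W :=
  TensorProduct.lid k W ∘ₗ (gcoeff h).rTensor W

@[simp]
theorem tcoeff_tmul (h : G) (a : MonoidAlgebra k G) (w : W) :
    tcoeff h (a ⊗ₜ[k] w) = a.coeff h • w := by
  simp [tcoeff, gcoeff_apply]

/-- `kG ⊗ W` is the space of finitely supported functions `G → W`. -/
def tensorEquivFinsupp : MonoidAlgebra k G ⊗[k] W ≃ₗ[k] G →₀ W := by
  classical
  exact (MonoidAlgebra.coeffLinearEquiv (M := G) (S := k) k).rTensor W ≪≫ₗ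
    TensorProduct.finsuppScalarLeft k W G

theorem tensorEquivFinsupp_apply (z : MonoidAlgebra k G ⊗[k] W) (h : G) :
    tensorEquivFinsupp z h = tcoeff h z := by
  classical
  induction z using TensorProduct.induction_on with
  | zero => simp
  | tmul a w =>
    rw [tcoeff_tmul]
    simp only [tensorEquivFinsupp, LinearEquiv.trans_apply, LinearEquiv.rTensor_tmul]
    exact TensorProduct.finsuppScalarLeft_apply_tmul_apply _ _ _
  | add a b ha hb => rw [map_add, Finsupp.add_apply, ha, hb, map_add]

theorem tcoeff_ext {z z' : MonoidAlgebra k G ⊗[k] W} (h : ∀ g, tcoeff g z = tcoeff g z') :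
    z = z' := by
  apply tensorEquivFinsupp.injective
  ext g
  rw [tensorEquivFinsupp_apply, tensorEquivFinsupp_apply, h]

theorem finite_tcoeff_ne_zero (z : MonoidAlgebra k G ⊗[k] W) :
    {h : G | tcoeff h z ≠ 0}.Finite := by
  refine (tensorEquivFinsupp z).hasFiniteSupport.subset fun h hh => ?_
  rw [Function.mem_support, tensorEquivFinsupp_apply]
  exact hh

theorem gcoeff_lTensor (f : Module.Dual k W) (z : MonoidAlgebra k G ⊗[k] W) (h : G) :
    (TensorProduct.rid k (MonoidAlgebra k G) (f.lTensor (MonoidAlgebra k G) z)).coeff h =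
      f (tcoeff h z) := by
  induction z using TensorProduct.induction_on with
  | zero => simp
  | tmul a w => simp [mul_comm]
  | add a b ha hb => simp only [map_add, MonoidAlgebra.coeff_add, Finsupp.add_apply, ha, hb]

end Coefficients

end BraidedDoubles
end

noncomputable section

namespace BraidedDoubles

universe u v w x

section PBW

variable {k : Type u} {G : Type v} {V : Type w} [Field k] [AddCommGroup V] [Module k V]

/-! ### The pairing -/

section Pairing

variable (δ : V →ₗ[k] MonoidAlgebra k G ⊗[k] V)

theorem coeff_pairing (f : Module.Dual k V) (v : V) (h : G) :
    (pairing δ f v).coeff h = f (tcoeff h (δ v)) :=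
  gcoeff_lTensor f (δ v) h

theorem pairing_add_left (f f' : Module.Dual k V) (v : V) :
    pairing δ (f + f') v = pairing δ f v + pairing δ f' v := by
  ext h; simp [coeff_pairing]

theorem pairing_smul_left (a : k) (f : Module.Dual k V) (v : V) :
    pairing δ (a • f) v = a • pairing δ f v := by
  ext h; simp [coeff_pairing]

theorem pairing_add_right (f : Module.Dual k V) (v v' : V) :
    pairing δ f (v + v') = pairing δ f v + pairing δ f v' := by
  ext h; simp [coeff_pairing]

theorem pairing_smul_right (a : k) (f : Module.Dual k V) (v : V) :
    pairing δ f (a • v) = a • pairing δ f v := by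
  ext h; simp [coeff_pairing]

end Pairing

variable [Group G] (ρ : Representation k G V)

/-- Yetter-Drinfeld compatibility in terms of the components `L_h`. -/
theorem isYetterDrinfeld_iff {δ : V →ₗ[k] MonoidAlgebra k G ⊗[k] V} :
    IsYetterDrinfeld ρ δ ↔
      ∀ g h v, ρ g (tcoeff h (δ v)) = tcoeff (g * h * g⁻¹) (δ (ρ g v)) := by
  have hr : ∀ (g h : G) (z : MonoidAlgebra k G ⊗[k] V),
      tcoeff h ((LinearMap.mulRight k (MonoidAlgebra.of k G g)).rTensor V z) =
        tcoeff (h * g⁻¹) z := by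
    intro g h z
    induction z using TensorProduct.induction_on with
    | zero => simp
    | tmul a w => simp [MonoidAlgebra.coeff_mul_single_apply]
    | add a b ha hb => simp only [map_add, ha, hb]
  have hl : ∀ (g h : G) (z : MonoidAlgebra k G ⊗[k] V),
      tcoeff h (TensorProduct.map (LinearMap.mulLeft k (MonoidAlgebra.of k G g)) (ρ g) z) =
        ρ g (tcoeff (g⁻¹ * h) z) := by
    intro g h z
    induction z using TensorProduct.induction_on with
    | zero => simp
    | tmul a w => simp [MonoidAlgebra.coeff_single_mul_apply]
    | add a b ha hb => simp only [map_add, ha, hb]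
  constructor
  · intro H g h v
    -- At `g * h`, undoing the right multiplication by `g` leaves `g * h * g⁻¹`, and undoing the
    -- left one leaves `h`.
    have := congrArg (tcoeff (g * h)) (H g v)
    rw [hr, hl, inv_mul_cancel_left] at this
    exact this.symm
  · intro H g v
    refine tcoeff_ext fun h => ?_
    rw [hr, hl, H, mul_inv_cancel_left]

/-- This is the compatibility of the commutator relation with moving `g` through it; componentwise
it is the Yetter-Drinfeld condition paired with `f`. -/
theorem IsYetterDrinfeld.pairing_mul {ρ : Representation k G V}
    {δ : V →ₗ[k] MonoidAlgebra k G ⊗[k] V} (H : IsYetterDrinfeld ρ δ)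
    (g : G) (f : Module.Dual k V) (v : V) :
    pairing δ f (ρ g v) * MonoidAlgebra.of k G g =
      MonoidAlgebra.of k G g * pairing δ ((ρ g).dualMap f) v := by
  ext h
  rw [isYetterDrinfeld_iff] at H
  simp [MonoidAlgebra.coeff_mul_single_apply, MonoidAlgebra.coeff_single_mul_apply, coeff_pairing, H]

/-! ### Commuting vectors and covectors past `kG` -/

/-- The map `h ↦ h ⊗ h(w)`. -/
def smashV (w : V) : MonoidAlgebra k G →ₗ[k] MonoidAlgebra k G ⊗[k] V :=
  (MonoidAlgebra.basis G k).constr k fun h => MonoidAlgebra.of k G h ⊗ₜ ρ h w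

/-- The map `h ↦ h ⊗ (f ∘ h)`. -/
def smashD (f : Module.Dual k V) :
    MonoidAlgebra k G →ₗ[k] MonoidAlgebra k G ⊗[k] Module.Dual k V :=
  (MonoidAlgebra.basis G k).constr k fun h => MonoidAlgebra.of k G h ⊗ₜ (ρ h).dualMap f

@[simp]
theorem smashV_of (w : V) (h : G) :
    smashV ρ w (MonoidAlgebra.of k G h) = MonoidAlgebra.of k G h ⊗ₜ ρ h w := by
  have := (MonoidAlgebra.basis G k).constr_basis k
    (fun h => MonoidAlgebra.of k G h ⊗ₜ[k] ρ h w) h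
  simpa [smashV] using this

@[simp]
theorem smashD_of (f : Module.Dual k V) (h : G) :
    smashD ρ f (MonoidAlgebra.of k G h) = MonoidAlgebra.of k G h ⊗ₜ (ρ h).dualMap f := by
  have := (MonoidAlgebra.basis G k).constr_basis k
    (fun h => MonoidAlgebra.of k G h ⊗ₜ[k] (ρ h).dualMap f) h
  simpa [smashD] using this

/-- Linear maps out of `kG` agree if they agree on group elements. -/
theorem groupAlgebra_hom_ext {W : Type x} [AddCommMonoid W] [Module k W]
    {φ ψ : MonoidAlgebra k G →ₗ[k] W}
    (h : ∀ g, φ (MonoidAlgebra.of k G g) = ψ (MonoidAlgebra.of k G g)) : φ = ψ :=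
  (MonoidAlgebra.basis G k).ext fun g => by simpa using h g

theorem tcoeff_smashV (w : V) (a : MonoidAlgebra k G) (h : G) :
    tcoeff h (smashV ρ w a) = a.coeff h • ρ h w := by
  classical
  have : tcoeff h ∘ₗ smashV ρ w = (gcoeff h).smulRight (ρ h w) :=
    groupAlgebra_hom_ext fun g => by
      by_cases hg : g = h
      · subst hg; simp [gcoeff_apply, -MonoidAlgebra.of_apply]
      · simp only [LinearMap.comp_apply, smashV_of, tcoeff_tmul, LinearMap.smulRight_apply,
          gcoeff_apply]
        simp [hg]
  exact LinearMap.congr_fun this a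

theorem tcoeff_smashD (f : Module.Dual k V) (a : MonoidAlgebra k G) (h : G) :
    tcoeff h (smashD ρ f a) = a.coeff h • (ρ h).dualMap f := by
  classical
  have : tcoeff h ∘ₗ smashD ρ f = (gcoeff h).smulRight ((ρ h).dualMap f) :=
    groupAlgebra_hom_ext fun g => by
      by_cases hg : g = h
      · subst hg; simp [gcoeff_apply, -MonoidAlgebra.of_apply]
      · simp only [LinearMap.comp_apply, smashD_of, tcoeff_tmul, LinearMap.smulRight_apply,
          gcoeff_apply]
        simp [hg]
  exact LinearMap.congr_fun this a

end PBW

end BraidedDoubles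
end

noncomputable section

namespace BraidedDoubles

universe u v w x y

section Induced

/-! ### Modules induced from `kG ⋉ S(V*)` -/

variable {k : Type u} {G : Type v} {V : Type w} [Field k] [Group G] [AddCommGroup V] [Module k V]
  (ρ : Representation k G V) {N : Type x} [AddCommGroup N] [Module k N]

/-- The action of `V` on `S(V) ⊗ N`. -/
def actV : V →ₗ[k] Module.End k (SymQuot k V ⊗[k] N) :=
  LinearMap.rTensorHom N ∘ₗ LinearMap.mul k (SymQuot k V) ∘ₗ SymQuot.ι k V

@[simp]
theorem actV_tmul (v : V) (b : SymQuot k V) (n : N) :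
    actV v (b ⊗ₜ[k] n) = (SymQuot.ι k V v * b) ⊗ₜ n := rfl

theorem actV_comm (v w : V) (m : SymQuot k V ⊗[k] N) :
    actV v (actV w m) = actV w (actV v m) := by
  induction m using TensorProduct.induction_on with
  | zero => simp only [map_zero]
  | tmul b n => simp only [actV_tmul, mul_left_comm]
  | add a b ha hb => simp only [map_add, ha, hb]

/-- A subspace of `S(V) ⊗ N` that contains `1 ⊗ N` and is `V`-stable is everything. -/
theorem mem_of_actV_mem (S : Submodule k (SymQuot k V ⊗[k] N))
    (h1 : ∀ n : N, (1 : SymQuot k V) ⊗ₜ n ∈ S)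
    (hS : ∀ v, ∀ m ∈ S, actV v m ∈ S) (m : SymQuot k V ⊗[k] N) : m ∈ S := by
  induction m using TensorProduct.induction_on with
  | zero => exact S.zero_mem
  | tmul b n =>
    have : S.comap ((TensorProduct.mk k (SymQuot k V) N).flip n) = ⊤ :=
      SymQuot.eq_top_of_mul_mem _ (h1 n) fun v y hy => hS v _ hy
    exact this.ge (Submodule.mem_top (x := b))
  | add a b ha hb => exact S.add_mem ha hb

/-- The induction principle for identities on the induced module: agreement spreads from `1 ⊗ N`
because `V` generates `S(V)`. -/
theorem apply_eq_of_actV {W : Type y} [AddCommMonoid W] [Module k W]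
    (φ ψ : SymQuot k V ⊗[k] N →ₗ[k] W) (h1 : ∀ n, φ ((1 : SymQuot k V) ⊗ₜ n) = ψ (1 ⊗ₜ n))
    (hS : ∀ v m, φ m = ψ m → φ (actV v m) = ψ (actV v m)) (m : SymQuot k V ⊗[k] N) :
    φ m = ψ m :=
  mem_of_actV_mem (LinearMap.eqLocus φ ψ) h1 hS m

/-- The action of a group element on `S(V)`. -/
def symAct (g : G) : SymQuot k V →ₐ[k] SymQuot k V :=
  SymQuot.lift (SymQuot.ι k V ∘ₗ ρ g) fun _ _ => mul_comm _ _

@[simp]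
theorem symAct_ι (g : G) (v : V) : symAct ρ g (SymQuot.ι k V v) = SymQuot.ι k V (ρ g v) :=
  SymQuot.lift_ι _ _ _

theorem symAct_one : symAct ρ 1 = AlgHom.id k (SymQuot k V) :=
  SymQuot.hom_ext fun v => by simp

theorem symAct_mul (g h : G) : symAct ρ (g * h) = (symAct ρ g).comp (symAct ρ h) :=
  SymQuot.hom_ext fun v => by simp

variable (γ : MonoidAlgebra k G →ₐ[k] Module.End k N)

/-- The diagonal action of `G` on `S(V) ⊗ N`. -/
def actGroup : G →* Module.End k (SymQuot k V ⊗[k] N) where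
  toFun g := TensorProduct.map (symAct ρ g).toLinearMap (γ (MonoidAlgebra.of k G g))
  map_one' := TensorProduct.ext' fun b n => by
    rw [symAct_one, map_one, map_one, TensorProduct.map_tmul]
    rfl
  map_mul' g h := TensorProduct.ext' fun b n => by
    rw [symAct_mul, map_mul, map_mul, Module.End.mul_apply]
    simp only [TensorProduct.map_tmul]
    rfl

/-- The action of `kG` on `S(V) ⊗ N`. -/
def actG : MonoidAlgebra k G →ₐ[k] Module.End k (SymQuot k V ⊗[k] N) :=
  MonoidAlgebra.lift k (Module.End k (SymQuot k V ⊗[k] N)) G (actGroup ρ γ)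

theorem actG_of (g : G) : actG ρ γ (MonoidAlgebra.of k G g) = actGroup ρ γ g := by
  rw [actG, MonoidAlgebra.lift_of]

theorem actG_mul_apply (a b : MonoidAlgebra k G) (m : SymQuot k V ⊗[k] N) :
    actG ρ γ (a * b) m = actG ρ γ a (actG ρ γ b m) := by
  rw [map_mul, Module.End.mul_apply]

theorem actG_of_tmul (g : G) (b : SymQuot k V) (n : N) :
    actG ρ γ (MonoidAlgebra.of k G g) (b ⊗ₜ n) =
      symAct ρ g b ⊗ₜ γ (MonoidAlgebra.of k G g) n := by
  rw [actG_of]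
  rfl

theorem actG_one_tmul (a : MonoidAlgebra k G) (n : N) :
    actG ρ γ a ((1 : SymQuot k V) ⊗ₜ n) = 1 ⊗ₜ γ a n := by
  have : (LinearMap.applyₗ ((1 : SymQuot k V) ⊗ₜ[k] n)) ∘ₗ (actG ρ γ).toLinearMap =
      TensorProduct.mk k (SymQuot k V) N 1 ∘ₗ LinearMap.applyₗ n ∘ₗ γ.toLinearMap :=
    groupAlgebra_hom_ext fun g => by
      simp only [LinearMap.comp_apply, AlgHom.toLinearMap_apply, LinearMap.applyₗ_apply_apply,
        actG_of_tmul, map_one, TensorProduct.mk_apply]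
  exact LinearMap.congr_fun this a

theorem actG_of_actV (g : G) (v : V) (m : SymQuot k V ⊗[k] N) :
    actG ρ γ (MonoidAlgebra.of k G g) (actV v m) =
      actV (ρ g v) (actG ρ γ (MonoidAlgebra.of k G g) m) := by
  induction m using TensorProduct.induction_on with
  | zero => simp only [map_zero]
  | tmul b n => simp only [actV_tmul, actG_of_tmul, map_mul, symAct_ι]
  | add a b ha hb => simp only [map_add, ha, hb]

/-- For fixed `m`, the map `h ⊗ v ↦ v · h · m`. -/
def opV (m : SymQuot k V ⊗[k] N) : MonoidAlgebra k G ⊗[k] V →ₗ[k] SymQuot k V ⊗[k] N :=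
  TensorProduct.lift
    (LinearMap.mk₂ k (fun a v => actV v (actG ρ γ a m))
      (fun _ _ _ => by simp only [map_add, LinearMap.add_apply])
      (fun _ _ _ => by simp only [map_smul, LinearMap.smul_apply])
      (fun _ _ _ => by simp only [map_add, LinearMap.add_apply])
      (fun _ _ _ => by simp only [map_smul, LinearMap.smul_apply]))

theorem opV_tmul (m : SymQuot k V ⊗[k] N) (a : MonoidAlgebra k G) (v : V) :
    opV ρ γ m (a ⊗ₜ v) = actV v (actG ρ γ a m) := rfl

theorem actG_actV (a : MonoidAlgebra k G) (v : V) (m : SymQuot k V ⊗[k] N) :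
    actG ρ γ a (actV v m) = opV ρ γ m (smashV ρ v a) := by
  have : LinearMap.applyₗ (actV v m) ∘ₗ (actG ρ γ).toLinearMap = opV ρ γ m ∘ₗ smashV ρ v :=
    groupAlgebra_hom_ext fun g => by
      simp only [LinearMap.comp_apply, AlgHom.toLinearMap_apply, LinearMap.applyₗ_apply_apply,
        smashV_of, opV_tmul]
      exact actG_of_actV ρ γ g v m
  exact LinearMap.congr_fun this a

/-! ### Dunkl operators -/

variable (δ : V →ₗ[k] MonoidAlgebra k G ⊗[k] V)

/-- The symmetry of `[β(f, v), w]` in `v` and `w`. -/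
def SymmetricV : Prop :=
  ∀ (f : Module.Dual k V) (v w : V),
    smashV ρ w (pairing δ f v) - pairing δ f v ⊗ₜ[k] w =
      smashV ρ v (pairing δ f w) - pairing δ f w ⊗ₜ[k] v

/-- The symmetry of `[f, β(f', v)]` in `f` and `f'`. -/
def SymmetricD : Prop :=
  ∀ (f f' : Module.Dual k V) (v : V),
    smashD ρ f (pairing δ f' v) - pairing δ f' v ⊗ₜ[k] f =
      smashD ρ f' (pairing δ f v) - pairing δ f v ⊗ₜ[k] f'

variable {ρ δ}

/-- `opV` reads `h ⊗ u` as the operator `u h`, which turns the symmetry in `kG ⊗ V` into one of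
operators. -/
theorem SymmetricV.comm (hV : SymmetricV ρ δ) (f : Module.Dual k V) (v w : V)
    (m : SymQuot k V ⊗[k] N) :
    actV v (actG ρ γ (pairing δ f w) m) + actG ρ γ (pairing δ f v) (actV w m) =
      actV w (actG ρ γ (pairing δ f v) m) + actG ρ γ (pairing δ f w) (actV v m) := by
  have h := congrArg (opV ρ γ m) (hV f v w)
  rw [map_sub, map_sub, ← actG_actV, ← actG_actV, opV_tmul, opV_tmul,
    sub_eq_sub_iff_add_eq_add] at h
  rw [add_comm, h, add_comm]

variable (δ) in
/-- The operator `(m, m') ↦ (v m + β(f, v) m', v m')`. -/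
def dunklStep (f : Module.Dual k V) :
    V →ₗ[k] Module.End k ((SymQuot k V ⊗[k] N) × (SymQuot k V ⊗[k] N)) where
  toFun v := LinearMap.prod
    (actV v ∘ₗ LinearMap.fst k _ _ + actG ρ γ (pairing δ f v) ∘ₗ LinearMap.snd k _ _)
    (actV v ∘ₗ LinearMap.snd k _ _)
  map_add' v w := by
    refine LinearMap.ext fun m => Prod.ext ?_ ?_
    · change actV (v + w) m.1 + actG ρ γ (pairing δ f (v + w)) m.2 =
        (actV v m.1 + actG ρ γ (pairing δ f v) m.2) + (actV w m.1 + actG ρ γ (pairing δ f w) m.2)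
      simp only [pairing_add_right, map_add, LinearMap.add_apply]
      abel
    · change actV (v + w) m.2 = actV v m.2 + actV w m.2
      simp only [map_add, LinearMap.add_apply]
  map_smul' a v := by
    refine LinearMap.ext fun m => Prod.ext ?_ ?_
    · change actV (a • v) m.1 + actG ρ γ (pairing δ f (a • v)) m.2 =
        a • (actV v m.1 + actG ρ γ (pairing δ f v) m.2)
      simp only [pairing_smul_right, map_smul, LinearMap.smul_apply, smul_add]
    · change actV (a • v) m.2 = a • actV v m.2
      simp only [map_smul, LinearMap.smul_apply]

theorem dunklStep_apply (f : Module.Dual k V) (v : V)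
    (p : (SymQuot k V ⊗[k] N) × (SymQuot k V ⊗[k] N)) :
    dunklStep (ρ := ρ) γ δ f v p =
      (actV v p.1 + actG ρ γ (pairing δ f v) p.2, actV v p.2) := rfl

/-- In block form the operator of `v` is upper triangular with diagonal `v, v` and corner `β(f, v)`.
The diagonals commute, and the corners `v β(f, w) + β(f, v) w` of the two products agree by
`SymmetricV.comm`. -/
theorem dunklStep_comm (hV : SymmetricV ρ δ) (f : Module.Dual k V) (v w : V) :
    dunklStep (N := N) (ρ := ρ) γ δ f v * dunklStep (ρ := ρ) γ δ f w =
      dunklStep (ρ := ρ) γ δ f w * dunklStep (ρ := ρ) γ δ f v := by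
  refine LinearMap.ext fun p => Prod.ext ?_ ?_
  · simp only [Module.End.mul_apply, dunklStep_apply, map_add]
    rw [add_assoc, add_assoc, hV.comm, actV_comm v w]
  · simp only [Module.End.mul_apply, dunklStep_apply]
    exact actV_comm v w _

/-- The extension of `dunklStep` to `S(V)`. -/
def dunklHom (hV : SymmetricV ρ δ) (f : Module.Dual k V) :
    SymQuot k V →ₐ[k] Module.End k ((SymQuot k V ⊗[k] N) × (SymQuot k V ⊗[k] N)) :=
  SymQuot.lift (B := Module.End k ((SymQuot k V ⊗[k] N) × (SymQuot k V ⊗[k] N)))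
    (dunklStep (ρ := ρ) γ δ f) (dunklStep_comm γ hV f)

theorem dunklHom_ι_mul (hV : SymmetricV ρ δ) (f : Module.Dual k V) (v : V) (b : SymQuot k V)
    (p : (SymQuot k V ⊗[k] N) × (SymQuot k V ⊗[k] N)) :
    dunklHom γ hV f (SymQuot.ι k V v * b) p =
      dunklStep (ρ := ρ) γ δ f v (dunklHom γ hV f b p) := by
  rw [map_mul, Module.End.mul_apply, dunklHom, SymQuot.lift_ι]

/-- The corner entry never reaches the second component, which therefore keeps a record of `b ⊗ n`
for `β(f, v)` to act on. -/
theorem dunklHom_snd (hV : SymmetricV ρ δ) (f : Module.Dual k V) (b : SymQuot k V)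
    (m : SymQuot k V ⊗[k] N) (n : N) : (dunklHom γ hV f b (m, 1 ⊗ₜ n)).2 = b ⊗ₜ n := by
  have : LinearMap.eqLocus (LinearMap.snd k _ _ ∘ₗ LinearMap.applyₗ (m, (1 : SymQuot k V) ⊗ₜ n) ∘ₗ
      (dunklHom γ hV f).toLinearMap) ((TensorProduct.mk k (SymQuot k V) N).flip n) = ⊤ := by
    refine SymQuot.eq_top_of_mul_mem _ ?_ fun v b hb => ?_
    · rw [LinearMap.mem_eqLocus]
      simp only [LinearMap.comp_apply, AlgHom.toLinearMap_apply, map_one]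
      rfl
    · rw [LinearMap.mem_eqLocus] at hb ⊢
      simp only [LinearMap.comp_apply, AlgHom.toLinearMap_apply, LinearMap.applyₗ_apply_apply,
        LinearMap.snd_apply, LinearMap.flip_apply, TensorProduct.mk_apply] at hb ⊢
      rw [dunklHom_ι_mul, dunklStep_apply, hb, actV_tmul]
  exact this.ge (Submodule.mem_top (x := b))

variable (d : Module.Dual k V →ₗ[k] Module.End k N)

/-- The Dunkl operator of `f ∈ V*` on `S(V) ⊗ N`. -/
def dunkl (hV : SymmetricV ρ δ) (f : Module.Dual k V) : Module.End k (SymQuot k V ⊗[k] N) :=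
  TensorProduct.lift (LinearMap.mk₂ k
    (fun b n => (dunklHom γ hV f b ((1 : SymQuot k V) ⊗ₜ d f n, 1 ⊗ₜ n)).1)
    (fun _ _ _ => by simp only [map_add, LinearMap.add_apply, Prod.fst_add])
    (fun _ _ _ => by simp only [map_smul, LinearMap.smul_apply, Prod.smul_fst])
    (fun _ _ _ => by
      simp only [map_add, TensorProduct.tmul_add, ← Prod.mk_add_mk, Prod.fst_add])
    (fun _ _ _ => by
      simp only [map_smul, TensorProduct.tmul_smul, ← Prod.smul_mk, Prod.smul_fst]))

theorem dunkl_tmul (hV : SymmetricV ρ δ) (f : Module.Dual k V) (b : SymQuot k V) (n : N) :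
    dunkl γ d hV f (b ⊗ₜ n) = (dunklHom γ hV f b ((1 : SymQuot k V) ⊗ₜ d f n, 1 ⊗ₜ n)).1 := rfl

theorem dunkl_one_tmul (hV : SymmetricV ρ δ) (f : Module.Dual k V) (n : N) :
    dunkl γ d hV f (1 ⊗ₜ n) = 1 ⊗ₜ d f n := by
  rw [dunkl_tmul, map_one, Module.End.one_apply]

/-- Prepending `v` to `b` applies one more `dunklStep`; its corner contributes `β(f, v)` applied to
the second component, which is `b ⊗ n`. Together with `dunkl_one_tmul` this rule determines the
operator, so the identities below follow by induction along `V`. -/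
theorem dunkl_actV (hV : SymmetricV ρ δ) (f : Module.Dual k V) (v : V) (m : SymQuot k V ⊗[k] N) :
    dunkl γ d hV f (actV v m) = actV v (dunkl γ d hV f m) + actG ρ γ (pairing δ f v) m := by
  induction m using TensorProduct.induction_on with
  | zero => simp only [map_zero, add_zero]
  | tmul b n =>
    rw [actV_tmul, dunkl_tmul, dunklHom_ι_mul, dunklStep_apply, dunklHom_snd, dunkl_tmul]
  | add a b ha hb =>
    simp only [map_add, ha, hb]
    abel

theorem dunkl_add (hV : SymmetricV ρ δ) (f f' : Module.Dual k V) (m : SymQuot k V ⊗[k] N) :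
    dunkl γ d hV (f + f') m = dunkl γ d hV f m + dunkl γ d hV f' m := by
  refine apply_eq_of_actV (dunkl γ d hV (f + f')) (dunkl γ d hV f + dunkl γ d hV f')
    (fun n => ?_) (fun v m h => ?_) m
  · simp only [LinearMap.add_apply, dunkl_one_tmul, map_add, TensorProduct.tmul_add]
  · rw [LinearMap.add_apply] at h ⊢
    simp only [dunkl_actV, h, pairing_add_left, map_add, LinearMap.add_apply]
    abel

theorem dunkl_smul (hV : SymmetricV ρ δ) (a : k) (f : Module.Dual k V)
    (m : SymQuot k V ⊗[k] N) : dunkl γ d hV (a • f) m = a • dunkl γ d hV f m := by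
  refine apply_eq_of_actV (dunkl γ d hV (a • f)) (a • dunkl γ d hV f)
    (fun n => ?_) (fun v m h => ?_) m
  · simp only [LinearMap.smul_apply, dunkl_one_tmul, map_smul, TensorProduct.tmul_smul]
  · rw [LinearMap.smul_apply] at h ⊢
    simp only [dunkl_actV, h, pairing_smul_left, map_smul, LinearMap.smul_apply, smul_add]

variable {γ d}

/-- Passing from `m` to `v m` adds `β(f, g v) g m` on one side and `g β(f ∘ g, v) m` on the other;
these agree by `pairing_mul`. -/
theorem dunkl_actG_of (hV : SymmetricV ρ δ) (hY : IsYetterDrinfeld ρ δ)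
    (hG : ∀ f g n, d f (γ (MonoidAlgebra.of k G g) n) =
      γ (MonoidAlgebra.of k G g) (d ((ρ g).dualMap f) n))
    (f : Module.Dual k V) (g : G) (m : SymQuot k V ⊗[k] N) :
    dunkl γ d hV f (actG ρ γ (MonoidAlgebra.of k G g) m) =
      actG ρ γ (MonoidAlgebra.of k G g) (dunkl γ d hV ((ρ g).dualMap f) m) := by
  refine apply_eq_of_actV (dunkl γ d hV f ∘ₗ actG ρ γ (MonoidAlgebra.of k G g))
    (actG ρ γ (MonoidAlgebra.of k G g) ∘ₗ dunkl γ d hV ((ρ g).dualMap f))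
    (fun n => ?_) (fun v m h => ?_) m
  · simp only [LinearMap.comp_apply, actG_one_tmul, dunkl_one_tmul, hG]
  · simp only [LinearMap.comp_apply] at h ⊢
    rw [actG_of_actV, dunkl_actV, h, dunkl_actV, map_add, actG_of_actV, ← actG_mul_apply, ← actG_mul_apply,
      hY.pairing_mul]

variable (γ d) in
/-- For fixed `m`, the map `h ⊗ f ↦ h · f · m`. -/
def opD (hV : SymmetricV ρ δ) (m : SymQuot k V ⊗[k] N) :
    MonoidAlgebra k G ⊗[k] Module.Dual k V →ₗ[k] SymQuot k V ⊗[k] N :=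
  TensorProduct.lift
    (LinearMap.mk₂ k (fun a f => actG ρ γ a (dunkl γ d hV f m))
      (fun _ _ _ => by simp only [map_add, LinearMap.add_apply])
      (fun _ _ _ => by simp only [map_smul, LinearMap.smul_apply])
      (fun _ _ _ => by simp only [dunkl_add, map_add])
      (fun _ _ _ => by simp only [dunkl_smul, map_smul]))

theorem opD_tmul (hV : SymmetricV ρ δ) (m : SymQuot k V ⊗[k] N) (a : MonoidAlgebra k G)
    (f : Module.Dual k V) : opD γ d hV m (a ⊗ₜ f) = actG ρ γ a (dunkl γ d hV f m) := rfl

theorem dunkl_actG (hV : SymmetricV ρ δ) (hY : IsYetterDrinfeld ρ δ)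
    (hG : ∀ f g n, d f (γ (MonoidAlgebra.of k G g) n) =
      γ (MonoidAlgebra.of k G g) (d ((ρ g).dualMap f) n))
    (f : Module.Dual k V) (a : MonoidAlgebra k G) (m : SymQuot k V ⊗[k] N) :
    dunkl γ d hV f (actG ρ γ a m) = opD γ d hV m (smashD ρ f a) := by
  have : dunkl γ d hV f ∘ₗ LinearMap.applyₗ m ∘ₗ (actG ρ γ).toLinearMap =
      opD γ d hV m ∘ₗ smashD ρ f :=
    groupAlgebra_hom_ext fun g => by
      simp only [LinearMap.comp_apply, AlgHom.toLinearMap_apply, LinearMap.applyₗ_apply_apply,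
        smashD_of, opD_tmul]
      exact dunkl_actG_of hV hY hG f g m
  exact LinearMap.congr_fun this a

/-- Dunkl operators commute. -/
theorem dunkl_comm (hV : SymmetricV ρ δ) (hD : SymmetricD ρ δ) (hY : IsYetterDrinfeld ρ δ)
    (hG : ∀ f g n, d f (γ (MonoidAlgebra.of k G g) n) =
      γ (MonoidAlgebra.of k G g) (d ((ρ g).dualMap f) n))
    (hc : ∀ f f' n, d f (d f' n) = d f' (d f n))
    (f f' : Module.Dual k V) (m : SymQuot k V ⊗[k] N) :
    dunkl γ d hV f (dunkl γ d hV f' m) = dunkl γ d hV f' (dunkl γ d hV f m) := by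
  refine apply_eq_of_actV (dunkl γ d hV f ∘ₗ dunkl γ d hV f')
    (dunkl γ d hV f' ∘ₗ dunkl γ d hV f) (fun n => ?_) (fun v m h => ?_) m
  · simp only [LinearMap.comp_apply, dunkl_one_tmul, hc f f']
  · simp only [LinearMap.comp_apply] at h ⊢
    -- Moving `f f'` past `v` produces `f β(f', v) + β(f, v) f'`; read as operators, `hD` says that
    -- this sum is symmetric in `f` and `f'`.
    have hs := congrArg (opD γ d hV m) (hD f f' v)
    rw [map_sub, map_sub, ← dunkl_actG hV hY hG, ← dunkl_actG hV hY hG, opD_tmul, opD_tmul,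
      sub_eq_sub_iff_add_eq_add] at hs
    simp only [dunkl_actV, map_add, h]
    rw [add_assoc, add_assoc, add_comm (actG ρ γ _ _) (dunkl γ d hV f _), hs,
      add_comm (dunkl γ d hV f' _)]

end Induced

end BraidedDoubles
end

noncomputable section

namespace BraidedDoubles

universe u v w x y

section PBW

variable {k : Type u} {G : Type v} {V : Type w} [Field k] [Group G] [AddCommGroup V] [Module k V]
  (ρ : Representation k G V)

/-! ### The quotient map from the free algebra -/

section Quotient

variable {ρ} {δ : V →ₗ[k] MonoidAlgebra k G ⊗[k] V} {Im : Ideal (TensorAlgebra k V)}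
  {Ip : Ideal (TensorAlgebra k (Module.Dual k V))}

variable (ρ δ Im Ip) in
/-- The quotient map from the free algebra to `Ã/⟨I⁻, I⁺⟩`. -/
def toAQuot : Gen k G V →ₐ[k] AQuot ρ δ Im Ip :=
  (RingQuot.mkAlgHom k _).comp (RingQuot.mkAlgHom k (Rel ρ δ))

theorem toAQuot_surjective : Function.Surjective (toAQuot ρ δ Im Ip) :=
  (RingQuot.mkAlgHom_surjective k _).comp (RingQuot.mkAlgHom_surjective k _)

theorem toAQuot_rel {x y : Gen k G V} (h : Rel ρ δ x y) :
    toAQuot ρ δ Im Ip x = toAQuot ρ δ Im Ip y :=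
  congrArg (RingQuot.mkAlgHom k _) (RingQuot.mkAlgHom_rel k h)

theorem quotV_ι [Im.IsTwoSided] (v : V) :
    quotV ρ δ Im Ip (Ideal.Quotient.mk Im (TensorAlgebra.ι k v)) =
      toAQuot ρ δ Im Ip (genV v) := by
  change RingQuot.mkAlgHom k _ (tildeV ρ δ (TensorAlgebra.ι k v)) = _
  rw [tildeV, TensorAlgebra.lift_ι_apply]
  rfl

theorem quotD_ι [Ip.IsTwoSided] (f : Module.Dual k V) :
    quotD ρ δ Im Ip (Ideal.Quotient.mk Ip (TensorAlgebra.ι k f)) =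
      toAQuot ρ δ Im Ip (genD f) := by
  change RingQuot.mkAlgHom k _ (tildeD ρ δ (TensorAlgebra.ι k f)) = _
  rw [tildeD, TensorAlgebra.lift_ι_apply]
  rfl

end Quotient

/-! ### The module `kG ⊗ S(V*)` -/

/-- The module `kG ⊗ S(V*)` over `kG ⋉ S(V*)`. -/
abbrev BaseModule (k : Type u) (G : Type v) (V : Type w) [Field k] [Group G] [AddCommGroup V]
    [Module k V] := MonoidAlgebra k G ⊗[k] SymQuot k (Module.Dual k V)

/-- Left multiplication by `kG` on `kG ⊗ S(V*)`. -/
def baseG : MonoidAlgebra k G →ₐ[k] Module.End k (BaseModule k G V) :=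
  (Module.End.rTensorAlgHom k (MonoidAlgebra k G) (SymQuot k (Module.Dual k V))).comp
    (Algebra.lmul k (MonoidAlgebra k G))

@[simp]
theorem baseG_tmul (a b : MonoidAlgebra k G) (φ : SymQuot k (Module.Dual k V)) :
    baseG (V := V) a (b ⊗ₜ φ) = (a * b) ⊗ₜ φ := rfl

theorem base_hom_ext {W : Type x} [AddCommMonoid W] [Module k W]
    {φ ψ : BaseModule k G V →ₗ[k] W}
    (h : ∀ g y, φ (MonoidAlgebra.of k G g ⊗ₜ y) = ψ (MonoidAlgebra.of k G g ⊗ₜ y)) : φ = ψ :=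
  TensorProduct.ext (groupAlgebra_hom_ext fun g => LinearMap.ext fun y => h g y)

/-- The map `h ⊗ φ ↦ h ⊗ (f ∘ h) φ`. -/
def baseDFun (f : Module.Dual k V) : Module.End k (BaseModule k G V) :=
  TensorProduct.lift ((MonoidAlgebra.basis G k).constr k fun h =>
    TensorProduct.mk k (MonoidAlgebra k G) (SymQuot k (Module.Dual k V))
      (MonoidAlgebra.of k G h) ∘ₗ
        LinearMap.mulLeft k (SymQuot.ι k (Module.Dual k V) ((ρ h).dualMap f)))

theorem baseDFun_tmul (f : Module.Dual k V) (h : G) (φ : SymQuot k (Module.Dual k V)) :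
    baseDFun ρ f (MonoidAlgebra.of k G h ⊗ₜ φ) =
      MonoidAlgebra.of k G h ⊗ₜ (SymQuot.ι k _ ((ρ h).dualMap f) * φ) := by
  have := (MonoidAlgebra.basis G k).constr_basis k (fun h =>
    TensorProduct.mk k (MonoidAlgebra k G) (SymQuot k (Module.Dual k V))
      (MonoidAlgebra.of k G h) ∘ₗ
        LinearMap.mulLeft k (SymQuot.ι k (Module.Dual k V) ((ρ h).dualMap f))) h
  rw [MonoidAlgebra.basis_apply, ← MonoidAlgebra.of_apply] at this
  rw [baseDFun, TensorProduct.lift.tmul, this]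
  rfl

/-- The action of `V*` on `kG ⊗ S(V*)`. -/
def baseD : Module.Dual k V →ₗ[k] Module.End k (BaseModule k G V) where
  toFun := baseDFun ρ
  map_add' f f' := base_hom_ext fun g y => by
    rw [LinearMap.add_apply, baseDFun_tmul, baseDFun_tmul, baseDFun_tmul, map_add, map_add,
      add_mul, TensorProduct.tmul_add]
  map_smul' a f := base_hom_ext fun g y => by
    rw [RingHom.id_apply, LinearMap.smul_apply, baseDFun_tmul, baseDFun_tmul, map_smul, map_smul,
      smul_mul_assoc, TensorProduct.tmul_smul]

theorem baseD_tmul (f : Module.Dual k V) (h : G) (φ : SymQuot k (Module.Dual k V)) :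
    baseD ρ f (MonoidAlgebra.of k G h ⊗ₜ φ) =
      MonoidAlgebra.of k G h ⊗ₜ (SymQuot.ι k _ ((ρ h).dualMap f) * φ) :=
  baseDFun_tmul ρ f h φ

theorem baseD_comm (f f' : Module.Dual k V) (n : BaseModule k G V) :
    baseD ρ f (baseD ρ f' n) = baseD ρ f' (baseD ρ f n) := by
  have : baseD ρ f ∘ₗ baseD (G := G) ρ f' = baseD ρ f' ∘ₗ baseD ρ f :=
    base_hom_ext fun g y => by
      simp only [LinearMap.comp_apply, baseD_tmul, mul_left_comm]
  exact LinearMap.congr_fun this n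

/-- Moving `f` past `g h` at once or in two steps agrees, since `f ∘ (g h) = (f ∘ g) ∘ h`. -/
theorem baseD_baseG (f : Module.Dual k V) (g : G) (n : BaseModule k G V) :
    baseD ρ f (baseG (MonoidAlgebra.of k G g) n) =
      baseG (MonoidAlgebra.of k G g) (baseD ρ ((ρ g).dualMap f) n) := by
  have : baseD ρ f ∘ₗ baseG (MonoidAlgebra.of k G g) =
      baseG (MonoidAlgebra.of k G g) ∘ₗ baseD ρ ((ρ g).dualMap f) :=
    base_hom_ext fun h y => by
      have hgh : (ρ (g * h)).dualMap f = (ρ h).dualMap ((ρ g).dualMap f) := by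
        ext v
        simp
      simp only [LinearMap.comp_apply, baseD_tmul, baseG_tmul, ← map_mul, hgh]
  exact LinearMap.congr_fun this n

/-! ### The action of the algebra on `S(V) ⊗ kG ⊗ S(V*)` -/

/-- The space `S(V) ⊗ kG ⊗ S(V*)`. -/
abbrev IndModule (k : Type u) (G : Type v) (V : Type w) [Field k] [Group G] [AddCommGroup V]
    [Module k V] := SymQuot k V ⊗[k] BaseModule k G V

variable {ρ} {δ : V →ₗ[k] MonoidAlgebra k G ⊗[k] V}

/-- The action of `V*` on `S(V) ⊗ kG ⊗ S(V*)`. -/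
def actD (hV : SymmetricV ρ δ) : Module.Dual k V →ₗ[k] Module.End k (IndModule k G V) where
  toFun f := dunkl baseG (baseD ρ) hV f
  map_add' f f' := LinearMap.ext fun m => dunkl_add _ _ hV f f' m
  map_smul' a f := LinearMap.ext fun m => dunkl_smul _ _ hV a f m

/-- The action of the free algebra on `S(V) ⊗ kG ⊗ S(V*)`. -/
def actGen (hV : SymmetricV ρ δ) : Gen k G V →ₐ[k] Module.End k (IndModule k G V) :=
  TensorAlgebra.lift k (LinearMap.coprod actV
    (LinearMap.coprod (actG ρ (baseG (V := V))).toLinearMap (actD hV)))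

theorem actGen_genV (hV : SymmetricV ρ δ) (v : V) : actGen hV (genV v) = actV v := by
  simp [actGen, genV]

theorem actGen_genH (hV : SymmetricV ρ δ) (a : MonoidAlgebra k G) :
    actGen hV (genH a) = actG ρ baseG a := by
  simp [actGen, genH]

theorem actGen_genD (hV : SymmetricV ρ δ) (f : Module.Dual k V) :
    actGen hV (genD f) = actD hV f := by
  simp [actGen, genD]

theorem actGen_rel (hV : SymmetricV ρ δ) (hY : IsYetterDrinfeld ρ δ) ⦃x y : Gen k G V⦄
    (h : Rel ρ δ x y) : actGen hV x = actGen hV y := by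
  cases h with
  | one => rw [actGen_genH, map_one, map_one]
  | mul a b => rw [map_mul (actGen hV), actGen_genH, actGen_genH, actGen_genH, map_mul (actG ρ baseG)]
  | smash_left g v =>
    rw [map_mul, map_mul, actGen_genH, actGen_genV, actGen_genV]
    exact LinearMap.ext fun m => actG_of_actV ρ baseG g v m
  | smash_right f g =>
    rw [map_mul, map_mul, actGen_genH, actGen_genD, actGen_genD]
    exact LinearMap.ext fun m => dunkl_actG_of hV hY (baseD_baseG ρ) f g m
  | comm f v =>
    rw [map_sub, map_mul, map_mul, actGen_genH, actGen_genD, actGen_genV, sub_eq_iff_eq_add']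
    exact LinearMap.ext fun m => dunkl_actV baseG (baseD ρ) hV f v m

/-- The action of `Ã` on `S(V) ⊗ kG ⊗ S(V*)`. -/
def actTilde (hV : SymmetricV ρ δ) (hY : IsYetterDrinfeld ρ δ) :
    ATilde ρ δ →ₐ[k] Module.End k (IndModule k G V) :=
  RingQuot.liftAlgHom k ⟨actGen hV, actGen_rel hV hY⟩

theorem actTilde_mk (hV : SymmetricV ρ δ) (hY : IsYetterDrinfeld ρ δ) (z : Gen k G V) :
    actTilde hV hY (RingQuot.mkAlgHom k (Rel ρ δ) z) = actGen hV z :=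
  RingQuot.liftAlgHom_mkAlgHom_apply _ _ _ _

theorem actTilde_comp_tildeV (hV : SymmetricV ρ δ) (hY : IsYetterDrinfeld ρ δ) :
    (actTilde hV hY).comp (tildeV ρ δ) = TensorAlgebra.lift k actV := by
  refine TensorAlgebra.hom_ext (LinearMap.ext fun v => ?_)
  simp [tildeV, actTilde_mk, actGen_genV]

theorem actTilde_comp_tildeD (hV : SymmetricV ρ δ) (hY : IsYetterDrinfeld ρ δ) :
    (actTilde hV hY).comp (tildeD ρ δ) = TensorAlgebra.lift k (actD hV) := by
  refine TensorAlgebra.hom_ext (LinearMap.ext fun v => ?_)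
  simp [tildeD, actTilde_mk, actGen_genD]

variable (ρ δ) in
/-- The quotient of `Ã` by the symmetric ideals. -/
abbrev SymDouble :=
  AQuot ρ δ (RingHom.ker (SymmetricAlgebra.algHom k V))
    (RingHom.ker (SymmetricAlgebra.algHom k (Module.Dual k V)))

/-- The symmetric ideals act by zero because the operators of `V` commute, and so do the Dunkl
operators. Only the latter needs `SymmetricD`; the action of `Ã` itself does not. -/
theorem actTilde_qrel (hV : SymmetricV ρ δ) (hD : SymmetricD ρ δ) (hY : IsYetterDrinfeld ρ δ)
    ⦃x y : ATilde ρ δ⦄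
    (h : QRel ρ δ (RingHom.ker (SymmetricAlgebra.algHom k V))
      (RingHom.ker (SymmetricAlgebra.algHom k (Module.Dual k V))) x y) :
    actTilde hV hY x = actTilde hV hY y := by
  cases h with
  | minus x hx =>
    rw [map_zero]
    refine (AlgHom.congr_fun (actTilde_comp_tildeV hV hY) x).trans ?_
    exact SymQuot.lift_eq_zero (B := Module.End k (IndModule k G V)) _ (fun v w => LinearMap.ext fun m => actV_comm v w m) hx
  | plus y hy =>
    rw [map_zero]
    refine (AlgHom.congr_fun (actTilde_comp_tildeD hV hY) y).trans ?_
    exact SymQuot.lift_eq_zero (B := Module.End k (IndModule k G V)) _ (fun f f' => LinearMap.ext fun m =>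
      dunkl_comm hV hD hY (baseD_baseG ρ) (baseD_comm ρ) f f' m) hy

/-- The action of the quotient of `Ã` on `S(V) ⊗ kG ⊗ S(V*)`. -/
def actDouble (hV : SymmetricV ρ δ) (hD : SymmetricD ρ δ) (hY : IsYetterDrinfeld ρ δ) :
    SymDouble ρ δ →ₐ[k] Module.End k (IndModule k G V) :=
  RingQuot.liftAlgHom k ⟨actTilde hV hY, actTilde_qrel hV hD hY⟩

variable (ρ δ) in
/-- The quotient map from the free algebra. -/
abbrev toDouble : Gen k G V →ₐ[k] SymDouble ρ δ := toAQuot ρ δ _ _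

theorem actDouble_toDouble (hV : SymmetricV ρ δ) (hD : SymmetricD ρ δ) (hY : IsYetterDrinfeld ρ δ)
    (z : Gen k G V) : actDouble hV hD hY (toDouble ρ δ z) = actGen hV z :=
  (RingQuot.liftAlgHom_mkAlgHom_apply k _ _ _).trans (actTilde_mk hV hY z)

/-! ### The multiplication map -/

variable (ρ δ)

/-- The map `S(V) → Ã/⟨I⁻, I⁺⟩`. -/
def symV : SymQuot k V →ₐ[k] SymDouble ρ δ :=
  quotV ρ δ (RingHom.ker (SymmetricAlgebra.algHom k V))
    (RingHom.ker (SymmetricAlgebra.algHom k (Module.Dual k V)))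

/-- The map `S(V*) → Ã/⟨I⁻, I⁺⟩`. -/
def symD : SymQuot k (Module.Dual k V) →ₐ[k] SymDouble ρ δ :=
  quotD ρ δ (RingHom.ker (SymmetricAlgebra.algHom k V))
    (RingHom.ker (SymmetricAlgebra.algHom k (Module.Dual k V)))

/-- The multiplication map for the symmetric ideals. -/
def symMul : IndModule k G V →ₗ[k] SymDouble ρ δ :=
  mulMap ρ δ (RingHom.ker (SymmetricAlgebra.algHom k V))
    (RingHom.ker (SymmetricAlgebra.algHom k (Module.Dual k V)))

variable {ρ δ}

/-- `SymQuot` unfolds to the very quotient that occurs in `mulMap`, so no transport is needed. -/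
theorem symMul_tmul (b : SymQuot k V) (a : MonoidAlgebra k G) (φ : SymQuot k (Module.Dual k V)) :
    symMul ρ δ (b ⊗ₜ (a ⊗ₜ φ)) = symV ρ δ b * (toDouble ρ δ (genH a) * symD ρ δ φ) := rfl

theorem symV_ι (v : V) : symV ρ δ (SymQuot.ι k V v) = toDouble ρ δ (genV v) := quotV_ι v

theorem symD_ι (f : Module.Dual k V) :
    symD ρ δ (SymQuot.ι k _ f) = toDouble ρ δ (genD f) := quotD_ι f

theorem symMul_actV (v : V) (m : IndModule k G V) :
    symMul ρ δ (actV v m) = toDouble ρ δ (genV v) * symMul ρ δ m := by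
  have : symMul ρ δ ∘ₗ actV v = LinearMap.mulLeft k (toDouble ρ δ (genV v)) ∘ₗ symMul ρ δ := by
    refine TensorProduct.ext (LinearMap.ext fun b => TensorProduct.ext' fun a φ => ?_)
    change symMul ρ δ (actV v (b ⊗ₜ _)) = toDouble ρ δ (genV v) * symMul ρ δ (b ⊗ₜ _)
    rw [actV_tmul, symMul_tmul, symMul_tmul, map_mul, symV_ι, mul_assoc]
  exact LinearMap.congr_fun this m

theorem symMul_one_tmul_tmul (a : MonoidAlgebra k G) (φ : SymQuot k (Module.Dual k V)) :
    symMul ρ δ (1 ⊗ₜ (a ⊗ₜ φ)) = toDouble ρ δ (genH a) * symD ρ δ φ := by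
  rw [symMul_tmul, map_one, one_mul]

theorem symMul_actG_of (g : G) (m : IndModule k G V) :
    symMul ρ δ (actG ρ baseG (MonoidAlgebra.of k G g) m) =
      toDouble ρ δ (genH (MonoidAlgebra.of k G g)) * symMul ρ δ m := by
  refine apply_eq_of_actV (symMul ρ δ ∘ₗ actG ρ baseG (MonoidAlgebra.of k G g))
    (LinearMap.mulLeft k (toDouble ρ δ (genH (MonoidAlgebra.of k G g))) ∘ₗ symMul ρ δ)
    (fun n => ?_) (fun v m h => ?_) m
  · simp only [LinearMap.comp_apply, LinearMap.mulLeft_apply, actG_one_tmul]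
    induction n using TensorProduct.induction_on with
    | zero => simp only [map_zero, TensorProduct.tmul_zero, mul_zero]
    | tmul a φ =>
      rw [baseG_tmul, symMul_one_tmul_tmul, symMul_one_tmul_tmul, toAQuot_rel (Rel.mul _ _),
        map_mul, mul_assoc]
    | add a b ha hb => simp only [map_add, TensorProduct.tmul_add, mul_add, ha, hb]
  · simp only [LinearMap.comp_apply, LinearMap.mulLeft_apply] at h ⊢
    rw [actG_of_actV, symMul_actV, h, symMul_actV, ← mul_assoc, ← mul_assoc, ← map_mul, ← map_mul,
      toAQuot_rel (Rel.smash_left g v)]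

theorem symMul_actG (a : MonoidAlgebra k G) (m : IndModule k G V) :
    symMul ρ δ (actG ρ baseG a m) = toDouble ρ δ (genH a) * symMul ρ δ m := by
  have : symMul ρ δ ∘ₗ LinearMap.applyₗ m ∘ₗ (actG ρ baseG).toLinearMap =
      LinearMap.mulRight k (symMul ρ δ m) ∘ₗ (toDouble ρ δ).toLinearMap ∘ₗ genH :=
    groupAlgebra_hom_ext fun g => symMul_actG_of g m
  exact LinearMap.congr_fun this a

theorem symMul_actD (hV : SymmetricV ρ δ) (f : Module.Dual k V) (m : IndModule k G V) :
    symMul ρ δ (actD hV f m) = toDouble ρ δ (genD f) * symMul ρ δ m := by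
  refine apply_eq_of_actV (symMul ρ δ ∘ₗ dunkl baseG (baseD ρ) hV f)
    (LinearMap.mulLeft k (toDouble ρ δ (genD f)) ∘ₗ symMul ρ δ)
    (fun n => ?_) (fun v m h => ?_) m
  · have : symMul ρ δ ∘ₗ TensorProduct.mk k _ _ 1 ∘ₗ baseD ρ f =
        LinearMap.mulLeft k (toDouble ρ δ (genD f)) ∘ₗ symMul ρ δ ∘ₗ
          TensorProduct.mk k _ _ 1 := base_hom_ext fun g φ => by
      simp only [LinearMap.comp_apply, LinearMap.mulLeft_apply, TensorProduct.mk_apply, baseD_tmul,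
        symMul_one_tmul_tmul]
      rw [map_mul, symD_ι, ← mul_assoc, ← mul_assoc, ← map_mul, ← map_mul,
        toAQuot_rel (Rel.smash_right f g)]
    rw [LinearMap.comp_apply, dunkl_one_tmul]
    exact LinearMap.congr_fun this n
  · simp only [LinearMap.comp_apply, LinearMap.mulLeft_apply] at h ⊢
    have hc : toDouble ρ δ _ = toDouble ρ δ _ := toAQuot_rel (Rel.comm f v)
    rw [map_sub, map_mul, map_mul, sub_eq_iff_eq_add'] at hc
    rw [dunkl_actV, map_add, symMul_actV, symMul_actG, h, symMul_actV, ← mul_assoc, ← mul_assoc,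
      ← add_mul, hc]

/-- Linearity over the algebra, checked on the three kinds of generators. At `m = 1 ⊗ 1 ⊗ 1` it
yields surjectivity of `symMul`. -/
theorem symMul_actDouble (hV : SymmetricV ρ δ) (hD : SymmetricD ρ δ) (hY : IsYetterDrinfeld ρ δ)
    (a : SymDouble ρ δ) (m : IndModule k G V) :
    symMul ρ δ (actDouble hV hD hY a m) = a * symMul ρ δ m := by
  obtain ⟨z, rfl⟩ := toAQuot_surjective a
  rw [actDouble_toDouble]
  induction z using TensorAlgebra.induction generalizing m with
  | algebraMap r =>
    rw [AlgHom.commutes, AlgHom.commutes, Module.algebraMap_end_apply, map_smul, Algebra.smul_def]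
  | ι p =>
    have hp : TensorAlgebra.ι k p = genV p.1 + (genH p.2.1 + genD p.2.2) := by
      simp only [genV, genH, genD, LinearMap.comp_apply, ← map_add]
      simp
    rw [hp]
    simp only [map_add, actGen_genV, actGen_genH, actGen_genD, LinearMap.add_apply, symMul_actV,
      symMul_actG, symMul_actD, add_mul]
  | mul x y hx hy => rw [map_mul, map_mul, Module.End.mul_apply, hx, hy, mul_assoc]
  | add x y hx hy => rw [map_add, map_add, LinearMap.add_apply, map_add, hx, hy, add_mul]

/-- On `1 ⊗ N` a Dunkl operator has no correction term, and on `1 ⊗ S(V*)` inside `N` it is plain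
multiplication by `f`. -/
theorem actDouble_symD (hV : SymmetricV ρ δ) (hD : SymmetricD ρ δ) (hY : IsYetterDrinfeld ρ δ)
    (φ : SymQuot k (Module.Dual k V)) :
    actDouble hV hD hY (symD ρ δ φ) (1 ⊗ₜ (1 ⊗ₜ 1)) = 1 ⊗ₜ (1 ⊗ₜ φ) := by
  have : LinearMap.eqLocus (LinearMap.applyₗ (1 ⊗ₜ (1 ⊗ₜ 1)) ∘ₗ
      (actDouble hV hD hY).toLinearMap ∘ₗ (symD ρ δ).toLinearMap)
      (TensorProduct.mk k (SymQuot k V) _ 1 ∘ₗ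
        TensorProduct.mk k (MonoidAlgebra k G) (SymQuot k (Module.Dual k V)) 1) = ⊤ := by
    refine SymQuot.eq_top_of_mul_mem _ ?_ fun f φ hφ => ?_
    · simp only [LinearMap.mem_eqLocus, LinearMap.comp_apply, AlgHom.toLinearMap_apply, map_one,
        LinearMap.applyₗ_apply_apply, Module.End.one_apply, TensorProduct.mk_apply]
    · simp only [LinearMap.mem_eqLocus, LinearMap.comp_apply, AlgHom.toLinearMap_apply, map_mul,
        LinearMap.applyₗ_apply_apply, Module.End.mul_apply, TensorProduct.mk_apply] at hφ ⊢
      rw [hφ, symD_ι, actDouble_toDouble, actGen_genD]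
      refine (dunkl_one_tmul _ _ hV f _).trans ?_
      have h1 := baseD_tmul ρ f 1 φ
      rw [map_one, map_one] at h1
      rw [h1]
      rfl
  exact this.ge (Submodule.mem_top (x := φ))

/-- Acting on `1 ⊗ 1 ⊗ 1` with a normally ordered product fills the three tensor slots from right to
left. This gives injectivity of `symMul`. -/
theorem actDouble_symMul (hV : SymmetricV ρ δ) (hD : SymmetricD ρ δ) (hY : IsYetterDrinfeld ρ δ)
    (m : IndModule k G V) :
    actDouble hV hD hY (symMul ρ δ m) (1 ⊗ₜ (1 ⊗ₜ 1)) = m := by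
  refine apply_eq_of_actV (LinearMap.applyₗ (1 ⊗ₜ (1 ⊗ₜ 1)) ∘ₗ
      (actDouble hV hD hY).toLinearMap ∘ₗ symMul ρ δ) LinearMap.id
    (fun n => ?_) (fun v m h => ?_) m
  · simp only [LinearMap.comp_apply, AlgHom.toLinearMap_apply, LinearMap.applyₗ_apply_apply,
      LinearMap.id_apply]
    induction n using TensorProduct.induction_on with
    | zero => simp only [map_zero, TensorProduct.tmul_zero, LinearMap.zero_apply]
    | tmul a φ =>
      rw [symMul_one_tmul_tmul, map_mul, Module.End.mul_apply, actDouble_symD, actDouble_toDouble,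
        actGen_genH, actG_one_tmul, baseG_tmul, mul_one]
    | add a b ha hb => simp only [map_add, TensorProduct.tmul_add, LinearMap.add_apply, ha, hb]
  · simp only [LinearMap.comp_apply, AlgHom.toLinearMap_apply, LinearMap.applyₗ_apply_apply,
      LinearMap.id_apply] at h ⊢
    rw [symMul_actV, map_mul, Module.End.mul_apply, h, actDouble_toDouble, actGen_genV]

theorem symMul_bijective (hV : SymmetricV ρ δ) (hD : SymmetricD ρ δ)
    (hY : IsYetterDrinfeld ρ δ) : Function.Bijective (symMul ρ δ) := by
  refine Function.bijective_iff_has_inverse.2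
    ⟨fun a => actDouble hV hD hY a (1 ⊗ₜ (1 ⊗ₜ 1)), actDouble_symMul hV hD hY, fun a => ?_⟩
  rw [symMul_actDouble, symMul_one_tmul_tmul, toAQuot_rel Rel.one, map_one, map_one, mul_one,
    mul_one]

/-- The triangular decomposition `S(V) ⋊ kG ⋉ S(V*)` under the symmetry conditions. -/
def symBraidedDouble (hV : SymmetricV ρ δ) (hD : SymmetricD ρ δ)
    (hY : IsYetterDrinfeld ρ δ) : BraidedDouble ρ δ where
  yetterDrinfeld := hY
  Iminus := RingHom.ker (SymmetricAlgebra.algHom k V)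
  Iplus := RingHom.ker (SymmetricAlgebra.algHom k (Module.Dual k V))
  twoSided_minus := inferInstance
  twoSided_plus := inferInstance
  Iminus_le := SymQuot.ker_algHom_le
  Iplus_le := SymQuot.ker_algHom_le
  triangular := symMul_bijective hV hD hY

end PBW

end BraidedDoubles
end

noncomputable section

namespace BraidedDoubles

universe u v w x y

/-! ### The symmetry conditions component by component -/

section Coefficients

variable {k : Type u} {G : Type v} {V : Type w} [Field k] [Group G] [AddCommGroup V] [Module k V]
  {ρ : Representation k G V} {δ : V →ₗ[k] MonoidAlgebra k G ⊗[k] V}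

/-- `SymmetricV` in terms of the components `L_h`. -/
theorem symmetricV_iff :
    SymmetricV ρ δ ↔ ∀ (h : G) (f : Module.Dual k V) (v w : V),
      f (tcoeff h (δ v)) • (ρ h w - w) = f (tcoeff h (δ w)) • (ρ h v - v) := by
  have key : ∀ (h : G) (f : Module.Dual k V) (v w : V),
      tcoeff h (smashV ρ w (pairing δ f v) - pairing δ f v ⊗ₜ[k] w) =
        f (tcoeff h (δ v)) • (ρ h w - w) := fun h f v w => by
    rw [map_sub, tcoeff_smashV, tcoeff_tmul, coeff_pairing, smul_sub]
  constructor
  · intro H h f v w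
    rw [← key, H, key]
  · intro H f v w
    refine tcoeff_ext fun h => ?_
    rw [key, key, H]

/-- `SymmetricD` in terms of the components `L_h`. -/
theorem symmetricD_iff :
    SymmetricD ρ δ ↔ ∀ (h : G) (f f' : Module.Dual k V) (v w : V),
      f' (tcoeff h (δ v)) * f (ρ h w - w) = f (tcoeff h (δ v)) * f' (ρ h w - w) := by
  have key : ∀ (h : G) (f f' : Module.Dual k V) (v w : V),
      tcoeff h (smashD ρ f (pairing δ f' v) - pairing δ f' v ⊗ₜ[k] f) w =
        f' (tcoeff h (δ v)) * f (ρ h w - w) := fun h f f' v w => by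
    rw [map_sub, tcoeff_smashD, tcoeff_tmul, coeff_pairing]
    simp [mul_sub]
  constructor
  · intro H h f f' v w
    rw [← key, H, key]
  · intro H f f' v
    refine tcoeff_ext fun h => LinearMap.ext fun w => ?_
    rw [key, key, H]

end Coefficients

/-! ### Consequences of the triangular decomposition -/

/-- Left cancellation, with the addition taken from the semiring structure. -/
theorem eq_of_add_eq_add_left {R : Type x} [Ring R] {a b c : R} (h : a + b = a + c) : b = c :=
  add_left_cancel h

namespace BraidedDouble

variable {k : Type u} {G : Type v} {V : Type w} [Field k] [Group G] [AddCommGroup V] [Module k V]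
  {ρ : Representation k G V} {δ : V →ₗ[k] MonoidAlgebra k G ⊗[k] V} (B : BraidedDouble ρ δ)

/-- The map `V → U⁻`. -/
def ιV : V →ₗ[k] B.Uminus :=
  (Ideal.Quotient.mkₐ k B.Iminus).toLinearMap ∘ₗ TensorAlgebra.ι k

/-- The map `V* → U⁺`. -/
def ιD : Module.Dual k V →ₗ[k] B.Uplus :=
  (Ideal.Quotient.mkₐ k B.Iplus).toLinearMap ∘ₗ TensorAlgebra.ι k

/-- The counit of `U⁻`. -/
def counitV : B.Uminus →ₐ[k] k :=
  Ideal.Quotient.liftₐ B.Iminus TensorAlgebra.algebraMapInv fun _ hx => B.Iminus_le hx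

/-- The counit of `U⁺`. -/
def counitD : B.Uplus →ₐ[k] k :=
  Ideal.Quotient.liftₐ B.Iplus TensorAlgebra.algebraMapInv fun _ hx => B.Iplus_le hx

/-- The quotient map from the free algebra. -/
abbrev toA : Gen k G V →ₐ[k] AQuot ρ δ B.Iminus B.Iplus := toAQuot ρ δ B.Iminus B.Iplus

/-- The multiplication map. -/
abbrev mulA : B.Uminus ⊗[k] (MonoidAlgebra k G ⊗[k] B.Uplus) →ₗ[k] AQuot ρ δ B.Iminus B.Iplus :=
  mulMap ρ δ B.Iminus B.Iplus

/-- The embedding `h ⊗ v ↦ v ⊗ h ⊗ 1`. -/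
def embV : MonoidAlgebra k G ⊗[k] V →ₗ[k] B.Uminus ⊗[k] (MonoidAlgebra k G ⊗[k] B.Uplus) :=
  TensorProduct.map B.ιV ((TensorProduct.mk k (MonoidAlgebra k G) B.Uplus).flip 1) ∘ₗ
    (TensorProduct.comm k (MonoidAlgebra k G) V).toLinearMap

/-- The embedding `h ⊗ f ↦ 1 ⊗ h ⊗ f`. -/
def embD : MonoidAlgebra k G ⊗[k] Module.Dual k V →ₗ[k]
    B.Uminus ⊗[k] (MonoidAlgebra k G ⊗[k] B.Uplus) :=
  TensorProduct.mk k B.Uminus (MonoidAlgebra k G ⊗[k] B.Uplus) 1 ∘ₗ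
    B.ιD.lTensor (MonoidAlgebra k G)

/-- The embedding `h ↦ 1 ⊗ h ⊗ 1`. -/
def embH : MonoidAlgebra k G →ₗ[k] B.Uminus ⊗[k] (MonoidAlgebra k G ⊗[k] B.Uplus) :=
  TensorProduct.mk k B.Uminus (MonoidAlgebra k G ⊗[k] B.Uplus) 1 ∘ₗ
    (TensorProduct.mk k (MonoidAlgebra k G) B.Uplus).flip 1

/-- The projection to the coefficient of `h` in `U⁻`. -/
def projV (h : G) : B.Uminus ⊗[k] (MonoidAlgebra k G ⊗[k] B.Uplus) →ₗ[k] B.Uminus :=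
  (TensorProduct.rid k B.Uminus).toLinearMap ∘ₗ
    (B.counitD.toLinearMap ∘ₗ tcoeff h).lTensor B.Uminus

/-- The projection to the coefficient of `h` in `U⁺`. -/
def projD (h : G) : B.Uminus ⊗[k] (MonoidAlgebra k G ⊗[k] B.Uplus) →ₗ[k] B.Uplus :=
  (TensorProduct.lid k B.Uplus).toLinearMap ∘ₗ
    TensorProduct.map B.counitV.toLinearMap (tcoeff h)

/-- The counit of `U⁺`, which exists because `I⁺ ⊆ T^{>0}(V*)`, removes the last factor; no grading
of `U⁺` is needed. Since the multiplication map is injective, elements `∑ v h` of the quotient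
algebra can thus be compared in `U⁻` for each `h` separately. -/
theorem projV_embV (h : G) (z : MonoidAlgebra k G ⊗[k] V) :
    B.projV h (B.embV z) = B.ιV (tcoeff h z) := by
  induction z using TensorProduct.induction_on with
  | zero => simp only [map_zero]
  | tmul a v => simp [projV, embV]
  | add a b ha hb => simp only [map_add, ha, hb]

theorem projD_embD (h : G) (z : MonoidAlgebra k G ⊗[k] Module.Dual k V) :
    B.projD h (B.embD z) = B.ιD (tcoeff h z) := by
  induction z using TensorProduct.induction_on with
  | zero => simp only [map_zero]
  | tmul a v => simp [projD, embD]
  | add a b ha hb => simp only [map_add, ha, hb]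

theorem counitD_projD_embH (h : G) (a : MonoidAlgebra k G) :
    B.counitD (B.projD h (B.embH a)) = a.coeff h := by
  simp [projD, embH]

theorem mulA_tmul (b : B.Uminus) (a : MonoidAlgebra k G) (φ : B.Uplus) :
    B.mulA (b ⊗ₜ (a ⊗ₜ φ)) = quotV ρ δ B.Iminus B.Iplus b *
      (B.toA (genH a) * quotD ρ δ B.Iminus B.Iplus φ) := rfl

theorem mulA_embV_tmul (a : MonoidAlgebra k G) (v : V) :
    B.mulA (B.embV (a ⊗ₜ v)) = B.toA (genV v) * B.toA (genH a) := by
  have : B.embV (a ⊗ₜ v) = B.ιV v ⊗ₜ (a ⊗ₜ 1) := rfl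
  rw [this, mulA_tmul, map_one, mul_one]
  exact congrArg (· * _) (quotV_ι v)

theorem mulA_embD_tmul (a : MonoidAlgebra k G) (f : Module.Dual k V) :
    B.mulA (B.embD (a ⊗ₜ f)) = B.toA (genH a) * B.toA (genD f) := by
  have : B.embD (a ⊗ₜ f) = 1 ⊗ₜ (a ⊗ₜ B.ιD f) := rfl
  rw [this, mulA_tmul, map_one, one_mul]
  exact congrArg (_ * ·) (quotD_ι f)

theorem mulA_embH (a : MonoidAlgebra k G) : B.mulA (B.embH a) = B.toA (genH a) := by
  have : B.embH a = 1 ⊗ₜ (a ⊗ₜ 1) := rfl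
  rw [this, mulA_tmul, map_one, map_one, one_mul, mul_one]

theorem mulA_embV_smashV (a : MonoidAlgebra k G) (v : V) :
    B.mulA (B.embV (smashV ρ v a)) = B.toA (genH a) * B.toA (genV v) := by
  have : B.mulA ∘ₗ B.embV ∘ₗ smashV ρ v =
      LinearMap.mulRight k (B.toA (genV v)) ∘ₗ B.toA.toLinearMap ∘ₗ genH :=
    groupAlgebra_hom_ext fun g => by
      change B.mulA (B.embV (smashV ρ v _)) = B.toA (genH _) * B.toA (genV v)
      rw [smashV_of, mulA_embV_tmul, ← map_mul, ← map_mul, toAQuot_rel (Rel.smash_left g v)]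
  exact LinearMap.congr_fun this a

theorem mulA_embD_smashD (a : MonoidAlgebra k G) (f : Module.Dual k V) :
    B.mulA (B.embD (smashD ρ f a)) = B.toA (genD f) * B.toA (genH a) := by
  have : B.mulA ∘ₗ B.embD ∘ₗ smashD ρ f =
      LinearMap.mulLeft k (B.toA (genD f)) ∘ₗ B.toA.toLinearMap ∘ₗ genH :=
    groupAlgebra_hom_ext fun g => by
      change B.mulA (B.embD (smashD ρ f _)) = B.toA (genD f) * B.toA (genH _)
      rw [smashD_of, mulA_embD_tmul, ← map_mul, ← map_mul, toAQuot_rel (Rel.smash_right f g)]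
  exact LinearMap.congr_fun this a

theorem toA_comm (f : Module.Dual k V) (v : V) :
    B.toA (genD f) * B.toA (genV v) =
      B.toA (genV v) * B.toA (genD f) + B.toA (genH (pairing δ f v)) := by
  have hc : B.toA _ = B.toA _ := toAQuot_rel (Rel.comm f v)
  rwa [map_sub, map_mul, map_mul, sub_eq_iff_eq_add'] at hc

theorem toA_genV_eq_zero_iff {v : V} : B.toA (genV v) = 0 ↔ B.ιV v = 0 := by
  have hq : quotV ρ δ B.Iminus B.Iplus (B.ιV v) = B.toA (genV v) := quotV_ι v
  refine ⟨fun h => ?_, fun h => by rw [← hq, h, map_zero]⟩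
  have h0 : B.mulA (B.embV (1 ⊗ₜ v)) = B.mulA 0 := by
    rw [mulA_embV_tmul, h, zero_mul, map_zero]
  have := B.projV_embV 1 (1 ⊗ₜ v)
  rw [B.triangular.1 h0, map_zero, tcoeff_tmul] at this
  simpa using this.symm

theorem toA_genD_eq_zero_iff {f : Module.Dual k V} : B.toA (genD f) = 0 ↔ B.ιD f = 0 := by
  have hq : quotD ρ δ B.Iminus B.Iplus (B.ιD f) = B.toA (genD f) := quotD_ι f
  refine ⟨fun h => ?_, fun h => by rw [← hq, h, map_zero]⟩
  have h0 : B.mulA (B.embD (1 ⊗ₜ f)) = B.mulA 0 := by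
    rw [mulA_embD_tmul, h, mul_zero, map_zero]
  have := B.projD_embD 1 (1 ⊗ₜ f)
  rw [B.triangular.1 h0, map_zero, tcoeff_tmul] at this
  simpa using this.symm

theorem eq_zero_of_toA_genH {a : MonoidAlgebra k G} (h : B.toA (genH a) = 0) : a = 0 := by
  have h0 : B.mulA (B.embH a) = B.mulA 0 := by rw [mulA_embH, h, map_zero]
  ext g
  rw [← B.counitD_projD_embH, B.triangular.1 h0, map_zero, map_zero]
  rfl

/-- Moving `f` to the right of `vw = wv` in both orders, the terms `v w f` cancel and `v β(f, w) +
β(f, v) w` is left symmetric. Normal ordering and comparison at each group element give the identity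
in `U⁻`, and injectivity of `V → U⁻` gives it in `V`. -/
theorem symmetricV (hc : ∀ x y : B.Uminus, x * y = y * x) (hinj : ∀ v, B.ιV v = 0 → v = 0) :
    SymmetricV ρ δ := by
  intro f v w
  have hvw : B.toA (genV v) * B.toA (genV w) = B.toA (genV w) * B.toA (genV v) := by
    have h := congrArg (quotV ρ δ B.Iminus B.Iplus) (hc (B.ιV v) (B.ιV w))
    rw [map_mul, map_mul] at h
    have hq : ∀ v, quotV ρ δ B.Iminus B.Iplus (B.ιV v) = B.toA (genV v) := quotV_ι
    rwa [hq, hq] at h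
  have hmove : ∀ v w : V, B.toA (genD f) * (B.toA (genV v) * B.toA (genV w)) =
      B.toA (genV v) * B.toA (genV w) * B.toA (genD f) +
        (B.toA (genV v) * B.toA (genH (pairing δ f w)) +
          B.toA (genH (pairing δ f v)) * B.toA (genV w)) := by
    intro v w
    rw [← mul_assoc, toA_comm, add_mul, mul_assoc, toA_comm, mul_add]
    simp only [mul_assoc, add_assoc]
  have h := hmove v w
  rw [hvw, hmove w v] at h
  replace h := eq_of_add_eq_add_left (R := AQuot ρ δ B.Iminus B.Iplus) h
  have hm : B.mulA (B.embV (smashV ρ w (pairing δ f v) - pairing δ f v ⊗ₜ[k] w)) =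
      B.mulA (B.embV (smashV ρ v (pairing δ f w) - pairing δ f w ⊗ₜ[k] v)) := by
    simp only [map_sub, mulA_embV_smashV, mulA_embV_tmul]
    rw [sub_eq_sub_iff_add_eq_add, add_comm, ← h, add_comm]
  have he := B.triangular.1 hm
  refine tcoeff_ext fun g => sub_eq_zero.1 (hinj _ ?_)
  rw [map_sub, ← projV_embV, ← projV_embV, he, sub_self]

/-- The mirror image: `v` is moved to the left of `ff' = f'f`, and components are compared in `U⁺`.
-/
theorem symmetricD (hc : ∀ x y : B.Uplus, x * y = y * x) (hinj : ∀ f, B.ιD f = 0 → f = 0) :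
    SymmetricD ρ δ := by
  intro f f' v
  have hff : B.toA (genD f) * B.toA (genD f') = B.toA (genD f') * B.toA (genD f) := by
    have h := congrArg (quotD ρ δ B.Iminus B.Iplus) (hc (B.ιD f) (B.ιD f'))
    rw [map_mul, map_mul] at h
    have hq : ∀ f, quotD ρ δ B.Iminus B.Iplus (B.ιD f) = B.toA (genD f) := quotD_ι
    rwa [hq, hq] at h
  have hmove : ∀ f f' : Module.Dual k V, B.toA (genD f) * B.toA (genD f') * B.toA (genV v) =
      B.toA (genV v) * (B.toA (genD f) * B.toA (genD f')) +
        (B.toA (genH (pairing δ f v)) * B.toA (genD f') +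
          B.toA (genD f) * B.toA (genH (pairing δ f' v))) := by
    intro f f'
    rw [mul_assoc, toA_comm, mul_add, ← mul_assoc, toA_comm, add_mul]
    simp only [mul_assoc, add_assoc]
  have h := hmove f f'
  rw [hff, hmove f' f] at h
  replace h := eq_of_add_eq_add_left (R := AQuot ρ δ B.Iminus B.Iplus) h
  have hm : B.mulA (B.embD (smashD ρ f (pairing δ f' v) - pairing δ f' v ⊗ₜ[k] f)) =
      B.mulA (B.embD (smashD ρ f' (pairing δ f v) - pairing δ f v ⊗ₜ[k] f')) := by
    simp only [map_sub, mulA_embD_smashD, mulA_embD_tmul]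
    rw [sub_eq_sub_iff_add_eq_add, add_comm, ← h, add_comm]
  have he := B.triangular.1 hm
  refine tcoeff_ext fun g => sub_eq_zero.1 (hinj _ ?_)
  rw [map_sub, ← projD_embD, ← projD_embD, he, sub_self]

theorem isUnit_toA_genH (g : G) : IsUnit (B.toA (genH (MonoidAlgebra.of k G g))) := by
  have hmul : ∀ g h : G, g * h = 1 → B.toA (genH (MonoidAlgebra.of k G g)) *
      B.toA (genH (MonoidAlgebra.of k G h)) = 1 := by
    intro g h hgh
    have h1 : B.toA _ = B.toA _ := toAQuot_rel
      (Rel.mul (MonoidAlgebra.of k G g) (MonoidAlgebra.of k G h))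
    have h2 : B.toA (genH 1) = B.toA 1 := toAQuot_rel Rel.one
    rw [← map_mul (B.toA), ← h1, ← map_mul, hgh, map_one, h2, map_one]
  exact ⟨⟨_, _, hmul g g⁻¹ (mul_inv_cancel g), hmul g⁻¹ g (inv_mul_cancel g)⟩, rfl⟩

/-- If `v` vanishes in the quotient algebra, so does `g v = g(v) g`, and `g` is invertible there. -/
theorem ιV_apply_eq_zero (g : G) {v : V} (hv : B.ιV v = 0) : B.ιV (ρ g v) = 0 := by
  rw [← toA_genV_eq_zero_iff] at hv ⊢
  have h : B.toA _ = B.toA _ := toAQuot_rel (Rel.smash_left g v)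
  rw [map_mul, map_mul, hv, mul_zero] at h
  exact ((B.isUnit_toA_genH g).mul_left_eq_zero).1 h.symm

theorem ιD_apply_eq_zero (g : G) {f : Module.Dual k V} (hf : B.ιD f = 0) :
    B.ιD ((ρ g).dualMap f) = 0 := by
  rw [← toA_genD_eq_zero_iff] at hf ⊢
  have h : B.toA _ = B.toA _ := toAQuot_rel (Rel.smash_right f g)
  rw [map_mul, map_mul, hf, zero_mul] at h
  exact ((B.isUnit_toA_genH g).mul_right_eq_zero).1 h.symm

theorem eq_zero_of_pairing (h : ∀ (f : Module.Dual k V) (v : V), pairing δ f v = 0) : δ = 0 := by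
  refine LinearMap.ext fun v => tcoeff_ext fun g => ?_
  rw [LinearMap.zero_apply, map_zero, ← Module.forall_dual_apply_eq_zero_iff k]
  intro f
  rw [← coeff_pairing, h]
  rfl

/-- The kernel of `V → U⁻` is a subrepresentation. If it is all of `V`, the commutator relation
reads `0 = β(f, v)`, and `kG` embeds, so `δ = 0`. -/
theorem ιV_injective_or (hirr : ρ.IsIrreducible) : (∀ v, B.ιV v = 0 → v = 0) ∨ δ = 0 := by
  let S : Subrepresentation ρ :=
    ⟨LinearMap.ker B.ιV, fun g v hv => B.ιV_apply_eq_zero g hv⟩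
  rcases hirr.eq_bot_or_eq_top S with h | h
  · have hk : LinearMap.ker B.ιV = ⊥ := congrArg Subrepresentation.toSubmodule h
    exact Or.inl fun v hv => by simpa [hk] using LinearMap.mem_ker.2 hv
  · have hk : LinearMap.ker B.ιV = ⊤ := congrArg Subrepresentation.toSubmodule h
    refine Or.inr (eq_zero_of_pairing fun f v => B.eq_zero_of_toA_genH ?_)
    have hv : B.toA (genV v) = 0 :=
      B.toA_genV_eq_zero_iff.2 (LinearMap.mem_ker.1 (hk.ge Submodule.mem_top))
    have := B.toA_comm f v
    rw [hv, mul_zero, zero_mul, zero_add] at this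
    exact this.symm

/-- Irreducibility is given for `V`, not `V*`, so it is applied to the common zeros in `V` of the
kernel; finite dimension recovers the kernel as their annihilator. -/
theorem ιD_injective_or [FiniteDimensional k V] (hirr : ρ.IsIrreducible) :
    (∀ f, B.ιD f = 0 → f = 0) ∨ δ = 0 := by
  let S : Subrepresentation ρ :=
    ⟨(LinearMap.ker B.ιD).dualCoannihilator, fun g v hv => by
      rw [Submodule.mem_dualCoannihilator] at hv ⊢
      exact fun f hf => hv _ (B.ιD_apply_eq_zero g hf)⟩
  have hK : (LinearMap.ker B.ιD).dualCoannihilator.dualAnnihilator = LinearMap.ker B.ιD :=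
    Subspace.dualCoannihilator_dualAnnihilator_eq
  rcases hirr.eq_bot_or_eq_top S with h | h
  · have hk : (LinearMap.ker B.ιD).dualCoannihilator = ⊥ :=
      congrArg Subrepresentation.toSubmodule h
    rw [hk, Submodule.dualAnnihilator_bot] at hK
    refine Or.inr (eq_zero_of_pairing fun f v => B.eq_zero_of_toA_genH ?_)
    have hf : B.toA (genD f) = 0 :=
      B.toA_genD_eq_zero_iff.2 (LinearMap.mem_ker.1 (hK.le Submodule.mem_top))
    have := B.toA_comm f v
    rw [hf, mul_zero, zero_mul, zero_add] at this
    exact this.symm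
  · have hk : (LinearMap.ker B.ιD).dualCoannihilator = ⊤ :=
      congrArg Subrepresentation.toSubmodule h
    rw [hk, Submodule.dualAnnihilator_top] at hK
    exact Or.inl fun f hf => by simpa [← hK] using LinearMap.mem_ker.2 hf

end BraidedDouble

end BraidedDoubles
end

noncomputable section

namespace BraidedDoubles

universe u w

section LinearGroup

variable {k : Type u} {V : Type w} [Field k] [AddCommGroup V] [Module k V]
  (G : Subgroup (LinearMap.GeneralLinearGroup k V))

/-! ### The quasicoaction `δ_{t,c}` -/

theorem one_notMem_complexReflections : (1 : G) ∉ complexReflections G := by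
  intro h
  have h' : Module.finrank k (LinearMap.range (1 - naturalRep G 1)) = 1 := h
  rw [map_one, sub_self, LinearMap.range_zero, finrank_bot] at h'
  exact zero_ne_one h'

theorem naturalRep_injective : Function.Injective (naturalRep G) := fun _ _ h =>
  Subtype.ext (Units.ext h)

theorem exists_naturalRep_apply_ne {h : G} (hh : h ≠ 1) : ∃ v, naturalRep G h v ≠ v := by
  by_contra! H
  exact hh (naturalRep_injective G (by rw [map_one]; exact LinearMap.ext H))

theorem conj_mem_complexReflections {s : G} (hs : s ∈ complexReflections G) (g : G) :
    g * s * g⁻¹ ∈ complexReflections G := by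
  let e := LinearMap.GeneralLinearGroup.toLinearEquiv (g : LinearMap.GeneralLinearGroup k V)
  have he : ∀ v, e v = naturalRep G g v := fun _ => rfl
  -- Conjugating `1 - s` by the invertible `g` preserves its rank.
  have hcomp : 1 - naturalRep G (g * s * g⁻¹) =
      (e.toLinearMap ∘ₗ (1 - naturalRep G s)) ∘ₗ naturalRep G g⁻¹ := by
    refine LinearMap.ext fun v => ?_
    have : naturalRep G g (naturalRep G g⁻¹ v) = v := by
      rw [← Module.End.mul_apply, ← map_mul, mul_inv_cancel, map_one, Module.End.one_apply]
    simp [he, this]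
  have hsurj : LinearMap.range (naturalRep G g⁻¹) = ⊤ := by
    refine LinearMap.range_eq_top.2 fun v => ⟨naturalRep G g v, ?_⟩
    rw [← Module.End.mul_apply, ← map_mul, inv_mul_cancel, map_one, Module.End.one_apply]
  change Module.finrank k _ = 1
  rw [hcomp, LinearMap.range_comp_of_range_eq_top _ hsurj, LinearMap.range_comp]
  exact (LinearEquiv.finrank_map_eq e _).trans hs

theorem conj_mem_complexReflections_iff {s g : G} :
    g * s * g⁻¹ ∈ complexReflections G ↔ s ∈ complexReflections G := by
  refine ⟨fun h => ?_, fun h => conj_mem_complexReflections G h g⟩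
  have := conj_mem_complexReflections G h g⁻¹
  rwa [show g⁻¹ * (g * s * g⁻¹) * g⁻¹⁻¹ = s by group] at this

variable {G}

theorem exists_apply_ne_of_mem_complexReflections {s : G} (hs : s ∈ complexReflections G) :
    ∃ v, v - naturalRep G s v ≠ 0 := by
  obtain ⟨v, hv⟩ := exists_naturalRep_apply_ne G
    (fun h => one_notMem_complexReflections G (h ▸ hs) : s ≠ 1)
  exact ⟨v, fun h => hv (sub_eq_zero.1 h).symm⟩

/-- All vectors `v - s(v)` are multiples of a single vector `x`, so both sides equal the same
multiple of `x`. -/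
theorem smul_sub_comm_of_mem_complexReflections {s : G} (hs : s ∈ complexReflections G)
    (f : Module.Dual k V) (v w : V) :
    f (v - naturalRep G s v) • (w - naturalRep G s w) =
      f (w - naturalRep G s w) • (v - naturalRep G s v) := by
  obtain ⟨x, -, hx⟩ := finrank_eq_one_iff'.1 hs
  have key : ∀ v, ∃ a : k, v - naturalRep G s v = a • (x : V) := fun v => by
    obtain ⟨a, ha⟩ := hx ⟨(1 - naturalRep G s) v, LinearMap.mem_range_self _ v⟩
    exact ⟨a, (congrArg Subtype.val ha).symm⟩
  obtain ⟨a, ha⟩ := key v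
  obtain ⟨b, hb⟩ := key w
  rw [ha, hb]
  simp only [map_smul, smul_smul, smul_eq_mul]
  ring_nf

variable (t : k) (c : complexReflections G →₀ k)

theorem deltaTC_apply (v : V) :
    deltaTC G t c v = t • ((1 : MonoidAlgebra k G) ⊗ₜ v) + c.sum fun s a =>
      a • (MonoidAlgebra.of k G s ⊗ₜ (v - naturalRep G s v)) := by
  rw [deltaTC, LinearMap.add_apply, Finsupp.sum, LinearMap.sum_apply]
  rfl

theorem tcoeff_deltaTC_one (v : V) : tcoeff 1 (deltaTC G t c v) = t • v := by
  rw [deltaTC_apply, map_add, map_finsuppSum, map_smul, tcoeff_tmul]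
  have h0 : (c.sum fun s a =>
      tcoeff 1 (a • (MonoidAlgebra.of k G s ⊗ₜ[k] (v - naturalRep G s v)))) = 0 :=
    Finset.sum_eq_zero fun s _ => by
      have hs : (s : G) ≠ 1 := fun h => one_notMem_complexReflections G (h ▸ s.2)
      dsimp only
      rw [map_smul, tcoeff_tmul, MonoidAlgebra.of_apply, MonoidAlgebra.coeff_single,
        Finsupp.single_eq_of_ne hs.symm, zero_smul, smul_zero]
  rw [h0, add_zero, MonoidAlgebra.one_def, MonoidAlgebra.coeff_single, Finsupp.single_eq_same,
    one_smul]

theorem tcoeff_deltaTC_of_ne_one {h : G} (hh : h ≠ 1) (v : V) :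
    tcoeff h (deltaTC G t c v) = c.sum fun s a =>
      a • ((Finsupp.single (s : G) (1 : k)) h • (v - naturalRep G s v)) := by
  rw [deltaTC_apply, map_add, map_finsuppSum, map_smul, tcoeff_tmul, MonoidAlgebra.one_def,
    MonoidAlgebra.coeff_single, Finsupp.single_eq_of_ne hh, zero_smul, smul_zero, zero_add]
  simp only [map_smul, tcoeff_tmul]
  rfl

theorem tcoeff_deltaTC_coe (s : complexReflections G) (v : V) :
    tcoeff (s : G) (deltaTC G t c v) = c s • (v - naturalRep G s v) := by
  classical
  have hs : (s : G) ≠ 1 := fun h => one_notMem_complexReflections G (h ▸ s.2)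
  rw [tcoeff_deltaTC_of_ne_one t c hs, Finsupp.sum, Finset.sum_eq_single s]
  · rw [Finsupp.single_eq_same, one_smul]
  · intro s' _ hne
    rw [Finsupp.single_eq_of_ne fun h => hne (Subtype.ext h.symm), zero_smul, smul_zero]
  · intro h
    rw [Finsupp.notMem_support_iff.1 h, zero_smul]

theorem tcoeff_deltaTC_of_notMem {h : G} (hh : h ≠ 1) (hs : h ∉ complexReflections G) (v : V) :
    tcoeff h (deltaTC G t c v) = 0 := by
  rw [tcoeff_deltaTC_of_ne_one t c hh]
  refine Finset.sum_eq_zero fun s _ => ?_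
  dsimp only
  have hne : h ≠ s := fun h' => hs (h' ▸ s.2)
  rw [Finsupp.single_eq_of_ne hne, zero_smul, smul_zero]

theorem isYetterDrinfeld_deltaTC (hc : IsConjInvariant G c) :
    IsYetterDrinfeld (naturalRep G) (deltaTC G t c) := by
  rw [isYetterDrinfeld_iff]
  intro g h v
  by_cases h1 : h = 1
  · subst h1
    rw [mul_one, mul_inv_cancel, tcoeff_deltaTC_one, tcoeff_deltaTC_one, map_smul]
  by_cases hs : h ∈ complexReflections G
  · have hs' := conj_mem_complexReflections G hs g
    rw [tcoeff_deltaTC_coe t c ⟨h, hs⟩, tcoeff_deltaTC_coe t c ⟨_, hs'⟩,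
      hc g ⟨h, hs⟩ ⟨_, hs'⟩ rfl, map_smul, map_sub]
    congr 2
    simp only [← Module.End.mul_apply, ← map_mul, inv_mul_cancel_right]
  · rw [tcoeff_deltaTC_of_notMem t c h1 hs, map_zero, tcoeff_deltaTC_of_notMem t c]
    · rwa [Ne, conj_eq_one_iff]
    · rwa [conj_mem_complexReflections_iff]

/-- At `h = 1` the factors `h w - w` vanish, at a reflection the image of `1 - s` is a line, and
elsewhere `L_h = 0`. -/
theorem symmetricV_deltaTC : SymmetricV (naturalRep G) (deltaTC G t c) := by
  rw [symmetricV_iff]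
  intro h f v w
  by_cases h1 : h = 1
  · subst h1
    simp
  by_cases hs : h ∈ complexReflections G
  · have key := smul_sub_comm_of_mem_complexReflections hs f v w
    rw [tcoeff_deltaTC_coe t c ⟨h, hs⟩, tcoeff_deltaTC_coe t c ⟨h, hs⟩, map_smul, map_smul,
      smul_assoc, smul_assoc, ← neg_sub w, ← neg_sub v]
    simp only [smul_neg, key]
  · rw [tcoeff_deltaTC_of_notMem t c h1 hs, tcoeff_deltaTC_of_notMem t c h1 hs, map_zero,
      zero_smul, zero_smul]

theorem symmetricD_deltaTC : SymmetricD (naturalRep G) (deltaTC G t c) := by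
  rw [symmetricD_iff]
  intro h f f' v w
  by_cases h1 : h = 1
  · subst h1
    simp
  by_cases hs : h ∈ complexReflections G
  · have key := congrArg f (smul_sub_comm_of_mem_complexReflections hs f' v w)
    rw [map_smul, map_smul, smul_eq_mul, smul_eq_mul] at key
    rw [tcoeff_deltaTC_coe t c ⟨h, hs⟩, ← neg_sub w, map_neg, map_neg, map_smul, map_smul,
      smul_eq_mul, smul_eq_mul]
    linear_combination (-c ⟨h, hs⟩) * key
  · rw [tcoeff_deltaTC_of_notMem t c h1 hs, map_zero, map_zero, zero_mul, zero_mul]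

/-! ### Classification of the quasicoactions -/

variable {δ : V →ₗ[k] MonoidAlgebra k G ⊗[k] V}

/-- `SymmetricD` confines `L_h` to the line of a fixed `hw - w ≠ 0`; `SymmetricV` then exchanges `v`
and `w`, turning the coefficient into a constant and the vector into `hv - v`. -/
theorem exists_tcoeff_eq_smul (hV : SymmetricV (naturalRep G) δ) (hD : SymmetricD (naturalRep G) δ)
    {h : G} (hh : h ≠ 1) : ∃ a : k, (∀ v, tcoeff h (δ v) = a • (v - naturalRep G h v)) ∧
      (a ≠ 0 → h ∈ complexReflections G) := by
  rw [symmetricV_iff] at hV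
  rw [symmetricD_iff] at hD
  obtain ⟨w, hw⟩ := exists_naturalRep_apply_ne G hh
  -- The normalisation `f(hw - w) = 1` lets `hD` be solved for `f'(L_h v)`.
  obtain ⟨f, hf⟩ := Module.Projective.exists_dual_eq_one k (sub_ne_zero.2 hw)
  have hL : ∀ v, tcoeff h (δ v) = f (tcoeff h (δ v)) • (naturalRep G h w - w) := by
    intro v
    rw [← sub_eq_zero, ← Module.forall_dual_apply_eq_zero_iff k]
    intro f'
    have := hD h f f' v w
    rw [hf, mul_one] at this
    rw [map_sub, map_smul, smul_eq_mul, this, sub_self]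
  have hL' : ∀ v, tcoeff h (δ v) =
      (-f (tcoeff h (δ w))) • (v - naturalRep G h v) := by
    intro v
    rw [hL v, hV h f v w, neg_smul, ← smul_neg, neg_sub]
  refine ⟨-f (tcoeff h (δ w)), hL', fun ha => ?_⟩
  refine finrank_eq_one_iff'.2
    ⟨⟨(1 - naturalRep G h) w, LinearMap.mem_range_self _ w⟩, fun h0 => ?_, ?_⟩
  · exact hw (sub_eq_zero.1 (congrArg Subtype.val h0)).symm
  · rintro ⟨_, v, rfl⟩
    -- Here `f(L_h w) (hv - v) = f(L_h v) (hw - w)`, and `f(L_h w) = -a` can be divided out, so `hw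
    -- - w` spans the image of `1 - h`.
    have e := hV h f w v
    have ha' : f (tcoeff h (δ w)) ≠ 0 := fun h0 => ha (by rw [h0, neg_zero])
    refine ⟨(f (tcoeff h (δ w)))⁻¹ * f (tcoeff h (δ v)), Subtype.ext ?_⟩
    change _ • (w - naturalRep G h w) = v - naturalRep G h v
    rw [← neg_sub _ w, ← neg_sub _ v, smul_neg, mul_smul, ← e, inv_smul_smul₀ ha']

theorem exists_eq_deltaTC [FiniteDimensional k V]
    (hEnd : ∀ L : Module.End k V, (∀ g : G, Commute L (naturalRep G g)) → ∃ t : k, L = t • 1)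
    (hY : IsYetterDrinfeld (naturalRep G) δ) (hV : SymmetricV (naturalRep G) δ)
    (hD : SymmetricD (naturalRep G) δ) :
    ∃ (t : k) (c : complexReflections G →₀ k), IsConjInvariant G c ∧ δ = deltaTC G t c := by
  rw [isYetterDrinfeld_iff] at hY
  -- Conjugation fixes `1`, so the Yetter-Drinfeld condition at `h = 1` says that `L_1` commutes
  -- with `G`.
  obtain ⟨t, ht⟩ := hEnd (tcoeff 1 ∘ₗ δ) fun g => LinearMap.ext fun v => by
    have := hY g 1 v
    rw [mul_one, mul_inv_cancel] at this
    exact this.symm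
  have hne : ∀ s : complexReflections G, (s : G) ≠ 1 := fun s h =>
    one_notMem_complexReflections G (h ▸ s.2)
  choose a ha _ using fun s : complexReflections G => exists_tcoeff_eq_smul hV hD (hne s)
  -- If `a s ≠ 0` then `L_s ≠ 0`, so `L_s` is nonzero on one of finitely many basis vectors, and
  -- each of these has only finitely many nonzero components.
  have hfin : (Function.support a).Finite := by
    let b := Module.finBasis k V
    have hU : (⋃ i, {h : G | tcoeff h (δ (b i)) ≠ 0}).Finite :=
      Set.finite_iUnion fun i => finite_tcoeff_ne_zero _
    refine (hU.preimage Subtype.val_injective.injOn).subset fun s hs => ?_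
    by_contra hmem
    simp only [Set.mem_preimage, Set.mem_iUnion, Set.mem_ofPred_eq, not_exists, not_not] at hmem
    have hz : tcoeff (s : G) ∘ₗ δ = 0 := b.ext hmem
    obtain ⟨v, hv⟩ := exists_apply_ne_of_mem_complexReflections s.2
    have := ha s v
    rw [← LinearMap.comp_apply, hz, LinearMap.zero_apply] at this
    exact smul_ne_zero hs hv this.symm
  refine ⟨t, Finsupp.ofSupportFinite a hfin, fun g s s' hs => ?_, ?_⟩
  -- Both coefficients multiply the same nonzero vector `g(v - s(v))`, so they can be compared.
  · obtain ⟨v, hv⟩ := exists_apply_ne_of_mem_complexReflections s.2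
    have h := hY g s v
    rw [← hs, ha, ha] at h
    have hg : naturalRep G g v - naturalRep G s' (naturalRep G g v) =
        naturalRep G g (v - naturalRep G s v) := by
      rw [hs, map_sub]
      simp only [← Module.End.mul_apply, ← map_mul, inv_mul_cancel_right]
    rw [hg, map_smul] at h
    have hv' : naturalRep G g (v - naturalRep G s v) ≠ 0 := fun h0 => hv <| by
      have := congrArg (naturalRep G g⁻¹) h0
      rwa [← Module.End.mul_apply, ← map_mul, inv_mul_cancel, map_one, Module.End.one_apply,
        map_zero] at this
    exact (smul_left_injective k hv' h).symm
  · refine LinearMap.ext fun v => tcoeff_ext fun h => ?_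
    by_cases h1 : h = 1
    · subst h1
      rw [tcoeff_deltaTC_one, ← LinearMap.comp_apply, ht]
      rfl
    by_cases hs : h ∈ complexReflections G
    · rw [tcoeff_deltaTC_coe t _ ⟨h, hs⟩]
      exact ha ⟨h, hs⟩ v
    · rw [tcoeff_deltaTC_of_notMem t _ h1 hs]
      obtain ⟨a', ha', hmem⟩ := exists_tcoeff_eq_smul hV hD h1
      rw [ha', not_ne_iff.1 (mt hmem hs), zero_smul]

end LinearGroup

end BraidedDoubles
end

/-! ### The main theorem -/

open BraidedDoubles in
theorem mainTheorem3 {k : Type*} {V : Type*} [Field k] [AddCommGroup V] [Module k V]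
    [FiniteDimensional k V] (G : Subgroup (LinearMap.GeneralLinearGroup k V))
    (hirr : (naturalRep G).IsIrreducible) :
    -- part 1, when Schur's lemma gives `End_{kG}(V) = k`
    ((∀ L : Module.End k V, (∀ g : G, Commute L (naturalRep G g)) → ∃ t : k, L = t • 1) →
      ∀ δ : V →ₗ[k] TensorProduct k (MonoidAlgebra k G) V,
        (∃ B : BraidedDouble (naturalRep G) δ,
            (∀ x y : B.Uminus, x * y = y * x) ∧ (∀ x y : B.Uplus, x * y = y * x)) ↔
          ∃ (t : k) (c : complexReflections G →₀ k),
            IsConjInvariant G c ∧ δ = deltaTC G t c) ∧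
    -- part 2
    (∀ (t : k) (c : complexReflections G →₀ k), IsConjInvariant G c →
      ∃ B : BraidedDouble (naturalRep G) (deltaTC G t c), B.IsSymmetric) := by
  refine ⟨fun hEnd δ => ⟨?_, ?_⟩, fun t c hc => ?_⟩
  · rintro ⟨B, hm, hp⟩
    -- The degenerate case, in which `V` or `V*` dies in `U⁻` or `U⁺`, is `δ_{0,0}`.
    have hzero : δ = 0 → ∃ (t : k) (c : complexReflections G →₀ k),
        IsConjInvariant G c ∧ δ = deltaTC G t c := fun h0 =>
      ⟨0, 0, fun _ _ _ _ => rfl, by simp [h0, deltaTC]⟩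
    rcases B.ιV_injective_or hirr with hV | h0
    · rcases B.ιD_injective_or hirr with hD | h0
      · exact exists_eq_deltaTC hEnd B.yetterDrinfeld (B.symmetricV hm hV) (B.symmetricD hp hD)
      · exact hzero h0
    · exact hzero h0
  · rintro ⟨t, c, hc, rfl⟩
    exact ⟨symBraidedDouble (symmetricV_deltaTC t c) (symmetricD_deltaTC t c)
      (isYetterDrinfeld_deltaTC t c hc), mul_comm (G := SymQuot k V),
      mul_comm (G := SymQuot k (Module.Dual k V))⟩
  · exact ⟨symBraidedDouble (symmetricV_deltaTC t c) (symmetricD_deltaTC t c)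
      (isYetterDrinfeld_deltaTC t c hc), rfl, rfl⟩
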